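/- Let $d\ge 1$ and let $\tilde{\mathcal X}\subseteq\mathbb R^d$ be a bounded set. There are constants $C_1,C_2,C_3>0$, depending only on $d$ and $\tilde{\mathcal X}$, such that the following holds. Let $\mathcal X\subseteq\mathbb R^D$ be a bounded set, let $(X,Y)$ be a random vector with values in $\mathcal X\times\{0,1\}$, and put $\eta(x)=\mathbb P(Y=1\mid X=x)$. Let $g:\tilde{\mathcal X}\to\mathbb R$ be $L_g$-Lipschitz with respect to the Euclidean norm. Then for every measurable transformation $f:\mathcal X\to\tilde{\mathcal X}$ and all integers $1\le k\le n$, $$\Big|\,\mathbb E_n\big[(R_{f(X)})_{n,k}\big]-R_X^*\,\Big|\;\le\; \frac{C_1}{\sqrt k}+C_2\,L_g\Big(\frac kn\Big)^{1/d}+C_3\,\sqrt[4]{\mathcal L_{g,X}(f)} .$$ Here $\mathcal L_{g,X}(f)=\mathbb E\big[\big(g(f(X))-\eta(X)\big)^2\big]$, and $R_X^*=\mathbb E\big[1-\max\{\eta(X),1-\eta(X)\}\big]$ is the Bayes error rate of $(X,Y)$. For a training sample $(x_1,y_1),\dots,(x_n,y_n)$ in $\mathcal X\times\{0,1\}$,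 the $n$-sample error $(R_{f(X)})_{n,k}$ is the probability, over an independent copy of $(X,Y)$, that $Y$ differs from the label that is most frequent among the $k$ transformed training points $f(x_i)$ nearest to $f(X)$ in Euclidean distance; equidistant training points are ordered by their index, and a tied vote is decided in favour of a fixed (arbitrary) label. $\mathbb E_n$ is the expectation over a training sample of $n$ independent copies of $(X,Y)$. -/

import Mathlib

open MeasureTheory
open scoped NNReal

/-- Number of votes for the label `y` among the `k` training points nearest to `x`. The permutation
`Tuple.sort` reorders the training points by increasing distance from `x`, points at the same
distance being listed in the order of their indices. -/
noncomputable def knnVotes {Z : Type*} [PseudoMetricSpace Z] {n : ℕ} (k : ℕ)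
    (S : Fin n → Z × Fin 2) (x : Z) (y : Fin 2) : ℕ :=
  (Finset.univ.filter fun i : Fin n =>
    (i : ℕ) < k ∧ (S (Tuple.sort (fun j => dist x (S j).1) i)).2 = y).card

/-- The `k`-nearest-neighbour classifier trained on the sample `S`: the label with the most votes
among the `k` nearest neighbours, and the label `t` if the vote is tied. -/
noncomputable def knnClassify {Z : Type*} [PseudoMetricSpace Z] {n : ℕ} (k : ℕ) (t : Fin 2)
    (S : Fin n → Z × Fin 2) (x : Z) : Fin 2 :=
  if knnVotes k S x 0 < knnVotes k S x 1 then 1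
  else if knnVotes k S x 1 < knnVotes k S x 0 then 0
  else t

/-- The error rate of the kNN classifier trained on the fixed sample `S`, for a test point drawn
from the law `P`. -/
noncomputable def knnError {Z : Type*} [PseudoMetricSpace Z] [MeasurableSpace Z]
    (P : Measure (Z × Fin 2)) {n : ℕ} (k : ℕ) (t : Fin 2) (S : Fin n → Z × Fin 2) : ℝ :=
  ∫ p, (if knnClassify k t S p.1 ≠ p.2 then (1 : ℝ) else 0) ∂P

/-- The expectation of the `n`-sample error rate of the kNN classifier over a training sample of `n`
independent points with law `P`. -/
noncomputable def expectedKnnError {Z : Type*} [PseudoMetricSpace Z] [MeasurableSpace Z]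
    (P : Measure (Z × Fin 2)) [SigmaFinite P] (n k : ℕ) (t : Fin 2) : ℝ :=
  ∫ S, knnError P k t S ∂(Measure.pi fun _ : Fin n => P)

/-- The posterior probability `p(y | x)` of the label `y` given the point `x`. -/
noncomputable def labelProb {Z : Type*} [MeasurableSpace Z] (P : Measure (Z × Fin 2))
    [IsFiniteMeasure P] (y : Fin 2) (x : Z) : ℝ :=
  (P.condKernel x).real {y}

/-- The Bayes error rate: the expectation of `1 - max_y p(y | X)`. -/
noncomputable def bayesError {Z : Type*} [MeasurableSpace Z] (P : Measure (Z × Fin 2))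
    [IsFiniteMeasure P] : ℝ :=
  ∫ x, (1 - max (labelProb P 0 x) (labelProb P 1 x)) ∂P.fst

/-- The `g`-squared loss of `f`: the expectation of `(g (f X) - p(1 | X)) ^ 2`. -/
noncomputable def squaredLoss {Z W : Type*} [MeasurableSpace Z] (P : Measure (Z × Fin 2))
    [IsFiniteMeasure P] (g : W → ℝ) (f : Z → W) : ℝ :=
  ∫ x, (g (f x) - labelProb P 1 x) ^ 2 ∂P.fst

/-- The law of `(f(X), Y)` when `(X, Y)` has law `P`. -/
noncomputable def transformedLaw {Z W : Type*} [MeasurableSpace Z] [MeasurableSpace W]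
    (P : Measure (Z × Fin 2)) (f : Z → W) : Measure (W × Fin 2) :=
  P.map fun p => (f p.1, p.2)

instance transformedLaw.instIsFiniteMeasure {Z W : Type*} [MeasurableSpace Z] [MeasurableSpace W]
    (P : Measure (Z × Fin 2)) [IsFiniteMeasure P] (f : Z → W) :
    IsFiniteMeasure (transformedLaw P f) := by
  unfold transformedLaw
  infer_instance

/-!
Let `Q` be the law of `(f(X), Y)`, `η` the posterior probability of the label `1` under `Q`, and
`h = |η - g|`. Everything about the nearest neighbour rule takes place under `Q`; the law `P` of
`(X, Y)` enters only at the end.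

On a fixed sample the excess risk at the test point `x` is at most twice the error of the vote share
as an estimate of `η x` (`max_sub_knnClassify_le`). Inserting `η` and `g` at the neighbours, this
error splits into four parts (`max_sub_labelProb_knnClassify_le`).

* The mean label noise of the neighbours. The choice of the neighbours depends on the points alone,
  so the residuals of different labels are uncorrelated, and the second moment of their sum is at
  most `k` (`integral_sq_sum_labelResidual_le`). This gives the term in `1 / √k`.
* The mean of `h` over the neighbours. Exchanging the test point with a training point turns its
  expectation into that of `h x`, times the number of training points having `x` among their `k`
  nearest neighbours. By Stone's lemma that number is at most a constant times `k`
  (`exists_sum_nnWeight_update_le`). Splitting ties by index does no harm: of two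
  training points different from `x` in a narrow cone with apex `x`, the one farther from `x` is
  strictly nearer to the other one than to `x`.
* `L` times the mean distance to the neighbours. For `n + 1` points in a ball of radius `B`, let
  `r j` be the mean distance from the point `j` to its `k` nearest others. The balls of radius
  `r j / 2` overlap at most `k` times, so comparing volumes bounds the sum of the `r j ^ d`
  (`sum_pow_le_of_card_lt`). The power mean inequality and exchangeability give the rate
  `(k / n) ^ (1 / d)` in every dimension `d ≥ 1`.
* The value `h x` at the test point itself.

Passing to the transformed data is a conditional expectation, so the mean of `h` is at most the mean
of `|g ∘ f - P(Y = 1 | X)|` (`integral_abs_labelProb_transformedLaw_sub_le`), and the Bayes errors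
of the two laws differ by at most twice this quantity. By Cauchy-Schwarz it is at most the square
root of the squared loss. Since the left-hand side never exceeds `1`, the square root may be
replaced by the fourth root.
-/

/-! ### Ranks of training points -/

/-- The rank, counted from `0`, of the `i`-th training point in the list of all training points
ordered by distance from `x`, with ties ordered by index. -/
noncomputable def nnRank {Z : Type*} [PseudoMetricSpace Z] {n : ℕ} (X : Fin n → Z) (x : Z)
    (i : Fin n) : ℕ :=
  (Finset.univ.filter fun j : Fin n =>
    dist x (X j) < dist x (X i) ∨ (dist x (X j) = dist x (X i) ∧ j < i)).card

/-- The indicator that the `i`-th training point is one of the `k` nearest neighbours of `x`. -/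
noncomputable def nnWeight {Z : Type*} [PseudoMetricSpace Z] {n : ℕ} (k : ℕ) (X : Fin n → Z)
    (x : Z) (i : Fin n) : ℝ :=
  if nnRank X x i < k then 1 else 0

section Rank

variable {Z : Type*} [PseudoMetricSpace Z] {n : ℕ}

lemma nnRank_sort (X : Fin n → Z) (x : Z) (l : Fin n) :
    nnRank X x (Tuple.sort (fun j => dist x (X j)) l) = l := by
  set d : Fin n → ℝ := fun j => dist x (X j) with hd
  set σ := Tuple.sort d with hσ
  obtain ⟨hmono, htie⟩ := Tuple.eq_sort_iff.1 hσ
  have key : ∀ j : Fin n, (d (σ j) < d (σ l) ∨ (d (σ j) = d (σ l) ∧ σ j < σ l)) ↔ j < l := by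
    intro j
    constructor
    · intro h
      by_contra hjl
      rcases (not_lt.1 hjl).eq_or_lt with rfl | hlj
      · rcases h with h | h
        · exact lt_irrefl _ h
        · exact lt_irrefl _ h.2
      · have h1 : d (σ l) ≤ d (σ j) := hmono hlj.le
        rcases h with h | h
        · exact absurd h (not_lt.2 h1)
        · exact lt_asymm h.2 (htie l j hlj h.1.symm)
    · intro hjl
      have h1 : d (σ j) ≤ d (σ l) := hmono hjl.le
      rcases h1.lt_or_eq with h | h
      · exact Or.inl h
      · exact Or.inr ⟨h, htie j l hjl h⟩
  have : nnRank X x (σ l) = (Finset.univ.filter fun j : Fin n => j < l).card := by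
    unfold nnRank
    symm
    refine Finset.card_bij (fun j _ => σ j) ?_ ?_ ?_
    · intro j hj
      simpa using (key j).2 (by simpa using hj)
    · intro a _ b _ h
      exact σ.injective h
    · intro b hb
      refine ⟨σ.symm b, ?_, by simp⟩
      have := (key (σ.symm b)).1 (by simpa using hb)
      simpa using this
  rw [this, Finset.filter_gt_eq_Iio, Fin.card_Iio]

lemma nnWeight_sort (k : ℕ) (X : Fin n → Z) (x : Z) (l : Fin n) :
    nnWeight k X x (Tuple.sort (fun j => dist x (X j)) l) = if (l : ℕ) < k then 1 else 0 := by
  rw [nnWeight, nnRank_sort]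

lemma nnWeight_nonneg (k : ℕ) (X : Fin n → Z) (x : Z) (i : Fin n) : 0 ≤ nnWeight k X x i := by
  unfold nnWeight; split_ifs <;> norm_num

lemma nnWeight_le_one (k : ℕ) (X : Fin n → Z) (x : Z) (i : Fin n) : nnWeight k X x i ≤ 1 := by
  unfold nnWeight; split_ifs <;> norm_num

lemma nnWeight_sq (k : ℕ) (X : Fin n → Z) (x : Z) (i : Fin n) :
    nnWeight k X x i ^ 2 = nnWeight k X x i := by
  unfold nnWeight; split_ifs <;> norm_num

lemma sum_nnWeight {k : ℕ} (hk : k ≤ n) (X : Fin n → Z) (x : Z) :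
    ∑ i, nnWeight k X x i = k := by
  rw [← Equiv.sum_comp (Tuple.sort fun j => dist x (X j))]
  simp only [nnWeight_sort]
  rw [Finset.sum_boole]
  congr 1
  rw [Fin.card_filter_val_lt, min_eq_right hk]

lemma knnVotes_eq_sum (k : ℕ) (S : Fin n → Z × Fin 2) (x : Z) (y : Fin 2) :
    (knnVotes k S x y : ℝ) =
      ∑ i, nnWeight k (fun j => (S j).1) x i * (if (S i).2 = y then 1 else 0) := by
  rw [← Equiv.sum_comp (Tuple.sort fun j => dist x (S j).1)]
  simp only [nnWeight_sort]
  rw [knnVotes, Finset.card_filter]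
  push_cast
  refine Finset.sum_congr rfl fun i _ => ?_
  by_cases h1 : (i : ℕ) < k <;> simp [h1]

lemma knnVotes_zero_add_one {k : ℕ} (hk : k ≤ n) (S : Fin n → Z × Fin 2) (x : Z) :
    (knnVotes k S x 0 : ℝ) + knnVotes k S x 1 = k := by
  rw [knnVotes_eq_sum, knnVotes_eq_sum, ← Finset.sum_add_distrib,
    ← sum_nnWeight hk (fun j => (S j).1) x]
  refine Finset.sum_congr rfl fun i _ => ?_
  have : (S i).2 = 0 ∨ (S i).2 = 1 := by generalize (S i).2 = a; fin_cases a <;> simp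
  rcases this with h | h <;> simp [h]

/-- The plug-in inequality: the loss of the label chosen by the vote, compared with the best label,
is at most twice the error made in estimating the probability of the label `1` by its share of the
votes. -/
lemma max_sub_knnClassify_le {k : ℕ} (hk0 : 1 ≤ k) (hk : k ≤ n) (t : Fin 2)
    (S : Fin n → Z × Fin 2) (x : Z) (p : Fin 2 → ℝ) (hp : p 0 + p 1 = 1) :
    max (p 0) (p 1) - p (knnClassify k t S x) ≤ 2 * |(knnVotes k S x 1 : ℝ) / k - p 1| := by
  have hk' : (0 : ℝ) < k := by exact_mod_cast hk0
  have hs := knnVotes_zero_add_one hk S x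
  set v0 := (knnVotes k S x 0 : ℝ) with hv0
  set v1 := (knnVotes k S x 1 : ℝ) with hv1
  have hone : v0 ≤ v1 → max (p 0) (p 1) - p 1 ≤ 2 * |v1 / k - p 1| := by
    intro h
    have h2 : (1 : ℝ) / 2 ≤ v1 / k := by rw [div_le_div_iff₀ two_pos hk']; linarith
    rcases max_cases (p 0) (p 1) with ⟨h3, h4⟩ | ⟨h3, h4⟩ <;> rw [h3]
    · linarith [le_abs_self (v1 / k - p 1)]
    · linarith [abs_nonneg (v1 / k - p 1)]
  have hzero : v1 ≤ v0 → max (p 0) (p 1) - p 0 ≤ 2 * |v1 / k - p 1| := by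
    intro h
    have h2 : v1 / k ≤ (1 : ℝ) / 2 := by rw [div_le_div_iff₀ hk' two_pos]; linarith
    rcases max_cases (p 0) (p 1) with ⟨h3, h4⟩ | ⟨h3, h4⟩ <;> rw [h3]
    · linarith [abs_nonneg (v1 / k - p 1)]
    · linarith [neg_le_abs (v1 / k - p 1)]
  unfold knnClassify
  split_ifs with h1 h2
  · exact hone (by rw [hv0, hv1]; exact_mod_cast h1.le)
  · exact hzero (by rw [hv0, hv1]; exact_mod_cast h2.le)
  · have h3 : knnVotes k S x 0 = knnVotes k S x 1 := by omega
    have h4 : v0 = v1 := by rw [hv0, hv1, h3]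
    have : t = 0 ∨ t = 1 := by fin_cases t <;> simp
    rcases this with rfl | rfl
    · exact hzero h4.ge
    · exact hone h4.le

end Rank

/-! ### Stone's lemma -/

/-- In a finite set listed in a strict order, at most `k` elements have fewer than `k`
predecessors. -/
lemma card_filter_card_lt_le {ι β : Type*} [LinearOrder β] (s : Finset ι) (key : ι → β)
    (hkey : Function.Injective key) (k : ℕ) :
    (s.filter fun i => (s.filter fun j => key j < key i).card < k).card ≤ k := by
  classical
  set t := s.filter fun i => (s.filter fun j => key j < key i).card < k with ht
  rcases t.eq_empty_or_nonempty with h | h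
  · simp [h]
  · obtain ⟨m, hm, hmax⟩ := t.exists_max_image key h
    have h1 : t.erase m ⊆ s.filter fun j => key j < key m := by
      intro j hj
      obtain ⟨hjm, hjt⟩ := Finset.mem_erase.1 hj
      refine Finset.mem_filter.2 ⟨(Finset.mem_filter.1 hjt).1, ?_⟩
      exact lt_of_le_of_ne (hmax j hjt) fun h => hjm (hkey h)
    have h2 := Finset.card_le_card h1
    have h3 := (Finset.mem_filter.1 hm).2
    rw [Finset.card_erase_of_mem hm] at h2
    omega

section Cones

variable {E : Type*} [NormedAddCommGroup E] [InnerProductSpace ℝ E]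

/-- Two vectors making an angle less than `π / 3`: the longer one is strictly closer to the shorter
one than to the origin. -/
lemma norm_sub_lt_of_dist_normalize_lt {u v : E} (hu : u ≠ 0) (hv : v ≠ 0) (hvu : ‖v‖ ≤ ‖u‖)
    (h : ‖(‖u‖⁻¹ • u) - (‖v‖⁻¹ • v)‖ < 1) : ‖u - v‖ < ‖u‖ := by
  have hu' : 0 < ‖u‖ := norm_pos_iff.2 hu
  have hv' : 0 < ‖v‖ := norm_pos_iff.2 hv
  have h1 : ‖(‖u‖⁻¹ • u) - (‖v‖⁻¹ • v)‖ ^ 2 < 1 := by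
    have := norm_nonneg ((‖u‖⁻¹ • u) - (‖v‖⁻¹ • v))
    nlinarith
  rw [norm_sub_sq_real, norm_smul, norm_smul, norm_inv, norm_inv, norm_norm, norm_norm,
    inv_mul_cancel₀ hu'.ne', inv_mul_cancel₀ hv'.ne', real_inner_smul_left,
    real_inner_smul_right] at h1
  have h2 : 1 / 2 < ‖u‖⁻¹ * (‖v‖⁻¹ * inner ℝ u v) := by linarith
  have h3 : ‖u‖ * ‖v‖ * (1 / 2) < inner ℝ u v := by
    have := mul_lt_mul_of_pos_left h2 (mul_pos hu' hv')
    have e : ‖u‖ * ‖v‖ * (‖u‖⁻¹ * (‖v‖⁻¹ * inner ℝ u v)) = inner ℝ u v := by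
      field_simp
    rwa [e] at this
  have h4 : ‖u - v‖ ^ 2 < ‖u‖ ^ 2 := by
    rw [norm_sub_sq_real]
    nlinarith
  exact lt_of_pow_lt_pow_left₀ 2 hu'.le h4

/-- Finitely many cones of small aperture cover a finite-dimensional space. -/
lemma exists_finite_cone_cover (E : Type*) [NormedAddCommGroup E] [InnerProductSpace ℝ E]
    [FiniteDimensional ℝ E] :
    ∃ (N : ℕ) (c : E → Fin N), ∀ u v : E, u ≠ 0 → v ≠ 0 → c u = c v → ‖v‖ ≤ ‖u‖ →
      ‖u - v‖ < ‖u‖ := by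
  classical
  obtain ⟨s, hs, hfin, hcov⟩ :=
    (isCompact_closedBall (0 : E) 1).finite_cover_balls (e := 1 / 2) (by norm_num)
  have hex : ∀ u : E, ∃ a : s, ‖u‖⁻¹ • u ∈ Metric.ball (a : E) (1 / 2) := by
    intro u
    have hmem : ‖u‖⁻¹ • u ∈ Metric.closedBall (0 : E) 1 := by
      rw [mem_closedBall_zero_iff, norm_smul, norm_inv, norm_norm]
      exact inv_mul_le_one
    obtain ⟨a, ha, h⟩ := Set.mem_iUnion₂.1 (hcov hmem)
    exact ⟨⟨a, ha⟩, h⟩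
  choose a ha using hex
  have : Fintype s := hfin.fintype
  refine ⟨Fintype.card s, fun u => Fintype.equivFin s (a u), fun u v hu hv huv hle => ?_⟩
  have hauv : a u = a v := (Fintype.equivFin s).injective huv
  refine norm_sub_lt_of_dist_normalize_lt hu hv hle ?_
  rw [← dist_eq_norm]
  have h1 := ha u
  have h2 := ha v
  rw [hauv] at h1
  rw [Metric.mem_ball] at h1 h2
  have := dist_triangle_right (‖u‖⁻¹ • u) (‖v‖⁻¹ • v) (a v : E)
  linarith

end Cones

/-- Stone's lemma. The right-hand side counts the training points that would have `x` among their
`k` nearest neighbours if `x` took their place in the sample; there are at most `γ k` of them.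
Within one cone with apex `x`, the training points other than `x` itself that are not among the
first `k` of that cone are strictly closer to `k` other training points than to `x`, so ties do not
matter there; the training points that coincide with `x` are counted apart, and there the order of
the indices decides. -/
lemma exists_sum_nnWeight_update_le {E : Type*} [NormedAddCommGroup E] [InnerProductSpace ℝ E]
    [FiniteDimensional ℝ E] (A : Set E) :
    ∃ γ : ℝ, 0 ≤ γ ∧ ∀ (n k : ℕ) (X : Fin n → A) (x : A),
      ∑ i, nnWeight k (Function.update X i x) (X i) i ≤ γ * k := by
  classical
  obtain ⟨N, c, hc⟩ := exists_finite_cone_cover E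
  refine ⟨N + 1, by positivity, fun n k X x => ?_⟩
  let key : Fin n → ℝ ×ₗ Fin n := fun i => toLex (dist x (X i), i)
  have hkey : Function.Injective key := by
    intro i j hij
    have : (dist x (X i), i) = (dist x (X j), j) := toLex.injective hij
    exact congrArg Prod.snd this
  -- `none` marks the points equal to `x`, `some a` the points in the cone with number `a`
  let cl : Fin n → Option (Fin N) := fun i =>
    if X i = x then none else some (c ((X i : E) - x))
  let s : Option (Fin N) → Finset (Fin n) := fun o => Finset.univ.filter fun i => cl i = o
  have hsub : ∀ i, nnRank (Function.update X i x) (X i) i < k →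
      ((s (cl i)).filter fun j => key j < key i).card < k := by
    intro i hi
    refine lt_of_le_of_lt (Finset.card_le_card ?_) hi
    intro j hj
    simp only [s, Finset.mem_filter, Finset.mem_univ, true_and] at hj ⊢
    obtain ⟨hcl, hlt⟩ := hj
    have hji : j ≠ i := fun h => by rw [h] at hlt; exact lt_irrefl _ hlt
    rw [Function.update_of_ne hji, Function.update_self]
    have hlt' : dist x (X j) < dist x (X i) ∨ (dist x (X j) = dist x (X i) ∧ j < i) :=
      Prod.Lex.toLex_lt_toLex.1 hlt
    by_cases hix : X i = x
    · have hjx : X j = x := by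
        by_contra hjx
        simp [cl, hix, hjx] at hcl
      rw [hix, hjx] at hlt' ⊢
      simpa using hlt'
    · have hjx : X j ≠ x := by
        intro hjx
        simp [cl, hix, hjx] at hcl
      have hcc : c ((X i : E) - x) = c ((X j : E) - x) := by
        simpa [cl, hix, hjx] using hcl.symm
      left
      have hle : dist x (X j) ≤ dist x (X i) := by
        rcases hlt' with h | h
        · exact h.le
        · exact h.1.le
      have := hc ((X i : E) - x) ((X j : E) - x)
        (sub_ne_zero.2 fun h => hix (Subtype.ext h)) (sub_ne_zero.2 fun h => hjx (Subtype.ext h))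
        hcc (by
          rw [← dist_eq_norm, ← dist_eq_norm, dist_comm _ (x : E), dist_comm _ (x : E)]
          exact hle)
      rw [Subtype.dist_eq, Subtype.dist_eq, dist_eq_norm, dist_eq_norm]
      simpa using this
  have hle : ∀ o, ((s o).filter fun i => nnRank (Function.update X i x) (X i) i < k).card ≤ k := by
    intro o
    refine (Finset.card_le_card ?_).trans (card_filter_card_lt_le (s o) key hkey k)
    intro i hi
    obtain ⟨h1, h2⟩ := Finset.mem_filter.1 hi
    refine Finset.mem_filter.2 ⟨h1, ?_⟩
    have h3 := hsub i h2
    rwa [(Finset.mem_filter.1 h1).2] at h3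
  have hcard : (Finset.univ.filter fun i => nnRank (Function.update X i x) (X i) i < k).card
      ≤ (N + 1) * k := by
    rw [Finset.card_eq_sum_card_fiberwise (f := cl) (t := Finset.univ) (by simp)]
    have : ∀ o ∈ (Finset.univ : Finset (Option (Fin N))),
        ((Finset.univ.filter fun i => nnRank (Function.update X i x) (X i) i < k).filter
          fun i => cl i = o).card ≤ k := by
      intro o _
      rw [Finset.filter_comm]
      exact hle o
    refine (Finset.sum_le_card_nsmul _ _ _ this).trans ?_
    simp
  simp only [nnWeight]
  rw [Finset.sum_boole]
  exact_mod_cast hcard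

/-! ### The mean distance to the nearest neighbours -/

/-- The mean distance of `x` from its `k` nearest training points. -/
noncomputable def nnMeanDist {Z : Type*} [PseudoMetricSpace Z] {n : ℕ} (k : ℕ) (X : Fin n → Z)
    (x : Z) : ℝ :=
  (∑ i, nnWeight k X x i * dist x (X i)) / k

lemma nnMeanDist_nonneg {Z : Type*} [PseudoMetricSpace Z] {n : ℕ} (k : ℕ) (X : Fin n → Z)
    (x : Z) : 0 ≤ nnMeanDist k X x :=
  div_nonneg (Finset.sum_nonneg fun _ _ => mul_nonneg (nnWeight_nonneg _ _ _ _) dist_nonneg)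
    (Nat.cast_nonneg k)

lemma nnMeanDist_le {Z : Type*} [PseudoMetricSpace Z] {n k : ℕ} (hk0 : 1 ≤ k) (hk : k ≤ n)
    (X : Fin n → Z) (x : Z) {M : ℝ} (hM : ∀ i, dist x (X i) ≤ M) : nnMeanDist k X x ≤ M := by
  have hk' : (0 : ℝ) < k := by exact_mod_cast hk0
  rw [nnMeanDist, div_le_iff₀ hk', mul_comm M, ← sum_nnWeight hk X x, Finset.sum_mul]
  exact Finset.sum_le_sum fun i _ => mul_le_mul_of_nonneg_left (hM i) (nnWeight_nonneg _ _ _ _)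

/-- Fewer than `k` points are nearer than the mean distance to the `k` nearest ones: otherwise all of
these would be nearer than their mean. -/
lemma card_dist_lt_nnMeanDist_lt {Z : Type*} [PseudoMetricSpace Z] {n k : ℕ} (hk0 : 1 ≤ k)
    (hk : k ≤ n) (X : Fin n → Z) (x : Z) :
    (Finset.univ.filter fun i => dist x (X i) < nnMeanDist k X x).card < k := by
  by_contra! hcon
  have hk' : (0 : ℝ) < k := by exact_mod_cast hk0
  have h1 : ∀ i, nnRank X x i < k → dist x (X i) < nnMeanDist k X x := by
    intro i hi
    by_contra! hge
    refine absurd (hcon.trans (Finset.card_le_card ?_)) (not_le.2 hi)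
    intro j hj
    simp only [Finset.mem_filter, Finset.mem_univ, true_and] at hj ⊢
    exact Or.inl (hj.trans_le hge)
  have h2 : ∑ i, nnWeight k X x i * dist x (X i) < ∑ i, nnWeight k X x i * nnMeanDist k X x := by
    refine Finset.sum_lt_sum (fun i _ => ?_) ?_
    · unfold nnWeight
      split_ifs with h
      · simpa using (h1 i h).le
      · simp
    · by_contra! hno
      have hzero : ∀ i, nnWeight k X x i = 0 := by
        intro i
        have := hno i (Finset.mem_univ i)
        unfold nnWeight at this ⊢
        split_ifs with h
        · rw [if_pos h] at this
          linarith [h1 i h]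
        · rfl
      have := sum_nnWeight hk X x
      simp only [hzero, Finset.sum_const_zero] at this
      exact hk'.ne this
  rw [← Finset.sum_mul, sum_nnWeight hk] at h2
  have h3 : nnMeanDist k X x * k = ∑ i, nnWeight k X x i * dist x (X i) := by
    rw [nnMeanDist, div_mul_cancel₀ _ hk'.ne']
  linarith

/-- If fewer than `k` of the other points lie within distance `r j` of the point `z j`, for every
`j`, then the balls of radius `r j / 2` cover no point more than `k` times. Comparing volumes bounds
the sum of the `r j ^ d`. -/
lemma sum_pow_le_of_card_lt {d m k : ℕ} (hd : 1 ≤ d) {B : ℝ} (hB : 0 < B)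
    (z : Fin m → EuclideanSpace ℝ (Fin d))
    (hz : ∀ j, ‖z j‖ ≤ B) (r : Fin m → ℝ) (hr0 : ∀ j, 0 ≤ r j) (hr : ∀ j, r j ≤ 2 * B)
    (hcard : ∀ j, (Finset.univ.filter fun i => i ≠ j ∧ dist (z j) (z i) < r j).card < k) :
    ∑ j, r j ^ d ≤ k * (4 * B) ^ d := by
  classical
  have : Nontrivial (EuclideanSpace ℝ (Fin d)) :=
    Module.nontrivial_of_finrank_pos (R := ℝ) (by rw [finrank_euclideanSpace_fin]; omega)
  set V := volume (Metric.ball (0 : EuclideanSpace ℝ (Fin d)) 1) with hV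
  have hV0 : V ≠ 0 := (Metric.measure_ball_pos _ _ one_pos).ne'
  have hVt : V ≠ ⊤ := measure_ball_lt_top.ne
  have hover : ∀ u, (Finset.univ.filter fun j => u ∈ Metric.ball (z j) (r j / 2)).card ≤ k := by
    intro u
    set J := Finset.univ.filter fun j => u ∈ Metric.ball (z j) (r j / 2) with hJ
    rcases J.eq_empty_or_nonempty with h | h
    · simp [h]
    · -- the centres of the balls containing `u` lie within `r m` of the centre of the largest ball
      obtain ⟨m, hm, hmax⟩ := J.exists_max_image r h
      have h1 : J.erase m ⊆ Finset.univ.filter fun i => i ≠ m ∧ dist (z m) (z i) < r m := by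
        intro i hi
        obtain ⟨him, hiJ⟩ := Finset.mem_erase.1 hi
        refine Finset.mem_filter.2 ⟨Finset.mem_univ _, him, ?_⟩
        have h2 := (Finset.mem_filter.1 hm).2
        have h3 := (Finset.mem_filter.1 hiJ).2
        rw [Metric.mem_ball] at h2 h3
        have := dist_triangle_left (z m) (z i) u
        linarith [hmax i hiJ]
      have h2 := Finset.card_le_card h1
      rw [Finset.card_erase_of_mem hm] at h2
      have := hcard m
      omega
  have hvol : ∑ j, volume (Metric.ball (z j) (r j / 2)) ≤
      k * volume (Metric.ball (0 : EuclideanSpace ℝ (Fin d)) (2 * B)) := by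
    have hsub : ∀ j, Metric.ball (z j) (r j / 2) ⊆ Metric.ball 0 (2 * B) := by
      intro j
      refine Metric.ball_subset_ball' ?_
      rw [dist_zero_right]
      linarith [hr j, hz j]
    calc ∑ j, volume (Metric.ball (z j) (r j / 2))
        = ∑ j, ∫⁻ u, (Metric.ball (z j) (r j / 2)).indicator 1 u := by
          simp [Metric.isOpen_ball.measurableSet]
      _ = ∫⁻ u, ∑ j, (Metric.ball (z j) (r j / 2)).indicator 1 u := by
          rw [lintegral_finsetSum]
          intro j _
          exact measurable_one.indicator Metric.isOpen_ball.measurableSet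
      _ ≤ ∫⁻ u, (Metric.ball (0 : EuclideanSpace ℝ (Fin d)) (2 * B)).indicator
            (fun _ => (k : ENNReal)) u := by
          refine lintegral_mono fun u => ?_
          by_cases hu : u ∈ Metric.ball (0 : EuclideanSpace ℝ (Fin d)) (2 * B)
          · rw [Set.indicator_of_mem hu]
            simp only [Set.indicator_apply, Pi.one_apply]
            rw [Finset.sum_boole]
            exact_mod_cast hover u
          · rw [Set.indicator_of_notMem hu]
            refine le_of_eq (Finset.sum_eq_zero fun j _ => ?_)
            exact Set.indicator_of_notMem (fun h => hu (hsub j h)) _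
      _ = k * volume (Metric.ball (0 : EuclideanSpace ℝ (Fin d)) (2 * B)) := by
          rw [lintegral_indicator_const Metric.isOpen_ball.measurableSet]
  simp only [fun j => Measure.addHaar_ball volume (z j) (div_nonneg (hr0 j) zero_le_two),
    Measure.addHaar_ball volume (0 : EuclideanSpace ℝ (Fin d)) (by positivity : 0 ≤ 2 * B),
    finrank_euclideanSpace_fin, ← hV] at hvol
  rw [← Finset.sum_mul, ← mul_assoc, ENNReal.mul_le_mul_iff_left hV0 hVt,
    ← ENNReal.ofReal_sum_of_nonneg (fun j _ => pow_nonneg (div_nonneg (hr0 j) zero_le_two) _),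
    ← ENNReal.ofReal_natCast, ← ENNReal.ofReal_mul (Nat.cast_nonneg k),
    ENNReal.ofReal_le_ofReal_iff (by positivity)] at hvol
  simp only [div_pow] at hvol
  rw [← Finset.sum_div, div_le_iff₀ (by positivity), mul_assoc, ← mul_pow] at hvol
  rwa [show 4 * B = 2 * B * 2 by ring]

/-- Power means turn a bound for the sum of the `d`-th powers into one for the mean. -/
lemma sum_div_le_of_sum_pow_le {d n k : ℕ} (hd : 1 ≤ d) (hn : 1 ≤ n) {B : ℝ} (hB : 0 < B)
    (r : Fin (n + 1) → ℝ) (hr0 : ∀ j, 0 ≤ r j) (h : ∑ j, r j ^ d ≤ k * B ^ d) :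
    (∑ j, r j) / (n + 1) ≤ B * ((k : ℝ) / n) ^ (1 / (d : ℝ)) := by
  have hn' : (0 : ℝ) < n := by exact_mod_cast hn
  have h1 := Real.pow_arith_mean_le_arith_mean_pow Finset.univ (fun _ : Fin (n + 1) =>
    1 / ((n : ℝ) + 1)) r (fun _ _ => by positivity)
    (by simp; field_simp) (fun j _ => hr0 j) d
  rw [← Finset.mul_sum, ← Finset.mul_sum] at h1
  have h2 : (1 / ((n : ℝ) + 1) * ∑ j, r j) ^ d ≤ (B * ((k : ℝ) / n) ^ (1 / (d : ℝ))) ^ d := by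
    have e : (((k : ℝ) / n) ^ (1 / (d : ℝ))) ^ d = (k : ℝ) / n := by
      rw [one_div]
      exact Real.rpow_inv_natCast_pow (by positivity) (by omega)
    rw [mul_pow B, e]
    refine h1.trans ?_
    calc 1 / ((n : ℝ) + 1) * ∑ j, r j ^ d ≤ 1 / (n : ℝ) * (k * B ^ d) := by
          refine mul_le_mul (one_div_le_one_div_of_le hn' (by linarith)) h
            (Finset.sum_nonneg fun j _ => pow_nonneg (hr0 j) _) (by positivity)
      _ = B ^ d * ((k : ℝ) / n) := by ring
  have h3 := le_of_pow_le_pow_left₀ (by omega : d ≠ 0) (by positivity) h2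
  rwa [one_div_mul_eq_div] at h3

/-- Among `n + 1` points of a ball of radius `B`, the average over all points of the mean distance
to the `k` nearest other points. The point number `j` trades places with the point number `0`, the
place of the test point. -/
lemma average_nnMeanDist_swap_le {d n k : ℕ} (hd : 1 ≤ d) (hk0 : 1 ≤ k) (hk : k ≤ n)
    {A : Set (EuclideanSpace ℝ (Fin d))} {B : ℝ} (hB : 0 < B) (hA : ∀ z ∈ A, ‖z‖ ≤ B)
    (z : Fin (n + 1) → A) :
    (∑ j, nnMeanDist k (fun i : Fin n => z (Equiv.swap 0 j i.succ)) (z (Equiv.swap 0 j 0)))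
      / (n + 1) ≤ 4 * B * ((k : ℝ) / n) ^ (1 / (d : ℝ)) := by
  classical
  refine sum_div_le_of_sum_pow_le hd (hk0.trans hk) (by positivity) _
    (fun j => nnMeanDist_nonneg _ _ _) ?_
  refine sum_pow_le_of_card_lt hd hB (fun j => (z j : EuclideanSpace ℝ (Fin d)))
    (fun j => hA _ (z j).2) _ (fun j => nnMeanDist_nonneg _ _ _) (fun j => ?_) (fun j => ?_)
  · refine nnMeanDist_le hk0 hk _ _ fun i => ?_
    rw [Subtype.dist_eq, dist_eq_norm]
    refine (norm_sub_le _ _).trans ?_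
    linarith [hA _ (z (Equiv.swap 0 j 0)).2, hA _ (z (Equiv.swap 0 j i.succ)).2]
  · refine lt_of_le_of_lt ?_ (card_dist_lt_nnMeanDist_lt hk0 hk
      (fun i : Fin n => z (Equiv.swap 0 j i.succ)) (z (Equiv.swap 0 j 0)))
    refine Finset.card_le_card_of_surjOn (fun i : Fin n => Equiv.swap 0 j i.succ) ?_
    intro i hi
    simp only [Finset.coe_filter, Finset.mem_univ, true_and, Set.mem_ofPred_eq] at hi
    have hne : Equiv.swap 0 j i ≠ 0 := by
      intro h
      apply hi.1
      rw [Equiv.swap_apply_eq_iff, Equiv.swap_apply_left] at h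
      exact h
    obtain ⟨l, hl⟩ := Fin.exists_succ_eq.2 hne
    have hli : Equiv.swap 0 j l.succ = i := by rw [hl, Equiv.swap_apply_self]
    refine ⟨l, ?_, hli⟩
    simp only [Finset.coe_filter, Finset.mem_univ, true_and, Set.mem_ofPred_eq]
    rw [hli]
    have h2 := hi.2
    rw [Equiv.swap_apply_left] at h2 ⊢
    exact h2

/-! ### Bounded functions on finite measure spaces -/

lemma integrable_of_abs_le {α : Type*} [MeasurableSpace α] {μ : Measure α} [IsFiniteMeasure μ]
    {φ : α → ℝ} (hφ : Measurable φ) {M : ℝ} (hM : ∀ a, |φ a| ≤ M) : Integrable φ μ :=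
  Integrable.of_bound hφ.aestronglyMeasurable M (Filter.Eventually.of_forall hM)

lemma integral_abs_le_sqrt {α : Type*} [MeasurableSpace α] {μ : Measure α} [IsProbabilityMeasure μ]
    {φ : α → ℝ} (hφ : Measurable φ) {M : ℝ} (hM : ∀ a, |φ a| ≤ M) :
    ∫ a, |φ a| ∂μ ≤ √(∫ a, φ a ^ 2 ∂μ) := by
  have hmem : MemLp (fun a => |φ a|) 2 μ :=
    MemLp.of_bound hφ.abs.aestronglyMeasurable M (Filter.Eventually.of_forall fun a => by
      simpa using hM a)
  have h := ProbabilityTheory.variance_nonneg (fun a => |φ a|) μ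
  rw [ProbabilityTheory.variance_eq_sub hmem] at h
  refine Real.le_sqrt_of_sq_le ?_
  simpa [sq_abs] using h

/-! ### Posterior label probabilities -/

section Label

variable {Z : Type*} [MeasurableSpace Z]

lemma integral_fst_eq (Q : Measure (Z × Fin 2)) {φ : Z → ℝ} (hφ : Measurable φ) :
    ∫ x, φ x ∂Q.fst = ∫ p, φ p.1 ∂Q := by
  rw [Measure.fst, integral_map measurable_fst.aemeasurable hφ.aestronglyMeasurable]

variable (Q : Measure (Z × Fin 2)) [IsFiniteMeasure Q]

lemma labelProb_nonneg (y : Fin 2) (x : Z) : 0 ≤ labelProb Q y x := measureReal_nonneg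

lemma labelProb_le_one (y : Fin 2) (x : Z) : labelProb Q y x ≤ 1 := measureReal_le_one

lemma labelProb_zero_add_one (x : Z) : labelProb Q 0 x + labelProb Q 1 x = 1 := by
  have h := sum_measureReal_singleton (μ := Q.condKernel x) (Finset.univ : Finset (Fin 2))
  rw [Finset.coe_univ, probReal_univ, Fin.sum_univ_two] at h
  exact h

lemma abs_labelProb_sub_le (x : Z) {a K : ℝ} (ha : |a| ≤ K) : |labelProb Q 1 x - a| ≤ 1 + K := by
  refine (abs_sub _ _).trans (add_le_add ?_ ha)
  rw [abs_of_nonneg (labelProb_nonneg Q _ _)]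
  exact labelProb_le_one Q _ _

lemma one_sub_max_labelProb_mem_Icc (x : Z) :
    1 - max (labelProb Q 0 x) (labelProb Q 1 x) ∈ Set.Icc (0 : ℝ) 1 :=
  ⟨sub_nonneg.2 (max_le (labelProb_le_one Q _ _) (labelProb_le_one Q _ _)),
    sub_le_self _ (le_max_of_le_left (labelProb_nonneg Q _ _))⟩

lemma abs_one_sub_max_labelProb_le (x : Z) :
    |1 - max (labelProb Q 0 x) (labelProb Q 1 x)| ≤ 1 := by
  have h := one_sub_max_labelProb_mem_Icc Q x
  rw [abs_of_nonneg h.1]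
  exact h.2

lemma measurable_labelProb (y : Fin 2) : Measurable (labelProb Q y) :=
  (Q.condKernel.measurable_coe (measurableSet_singleton y)).ennreal_toReal

/-- Averaging over the label given the point. -/
lemma integral_eq_integral_labelProb {φ : Z × Fin 2 → ℝ} (hm : Measurable φ) {M : ℝ}
    (hM : ∀ p, |φ p| ≤ M) :
    ∫ p, φ p ∂Q = ∫ p, (labelProb Q 0 p.1 * φ (p.1, 0) + labelProb Q 1 p.1 * φ (p.1, 1)) ∂Q := by
  rw [← Measure.integral_condKernel (integrable_of_abs_le hm hM)]
  have : ∀ x, ∫ y, φ (x, y) ∂Q.condKernel x =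
      labelProb Q 0 x * φ (x, 0) + labelProb Q 1 x * φ (x, 1) := by
    intro x
    rw [integral_fintype (Integrable.of_finite), Fin.sum_univ_two]
    rfl
  simp only [this]
  refine integral_fst_eq Q (φ := fun x => labelProb Q 0 x * φ (x, 0) + labelProb Q 1 x * φ (x, 1)) ?_
  exact ((measurable_labelProb Q 0).mul (hm.comp (by fun_prop))).add
    ((measurable_labelProb Q 1).mul (hm.comp (by fun_prop)))

/-- The deviation of the indicator of the label `1` from its conditional mean. -/
noncomputable def labelResidual (p : Z × Fin 2) : ℝ :=
  (if p.2 = 1 then 1 else 0) - labelProb Q 1 p.1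

lemma measurable_labelResidual : Measurable (labelResidual Q) := by
  refine Measurable.sub ?_ ((measurable_labelProb Q 1).comp measurable_fst)
  exact Measurable.ite (measurable_snd (measurableSet_singleton 1)) measurable_const
    measurable_const

lemma abs_labelResidual_le (p : Z × Fin 2) : |labelResidual Q p| ≤ 1 := by
  unfold labelResidual
  have h0 := labelProb_nonneg Q 1 p.1
  have h1 := labelProb_le_one Q 1 p.1
  rw [abs_le]
  split_ifs <;> constructor <;> linarith

lemma integral_mul_labelResidual {c : Z → ℝ} (hc : Measurable c) {M : ℝ} (hM : ∀ z, |c z| ≤ M) :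
    ∫ p, c p.1 * labelResidual Q p ∂Q = 0 := by
  rw [integral_eq_integral_labelProb Q (φ := fun p => c p.1 * labelResidual Q p) (M := M * 1)
    ((hc.comp measurable_fst).mul (measurable_labelResidual Q))]
  · rw [← integral_zero (Z × Fin 2) ℝ (μ := Q)]
    congr 1
    funext p
    have h := labelProb_zero_add_one Q p.1
    have h0 : labelProb Q 0 p.1 = 1 - labelProb Q 1 p.1 := by linarith
    simp only [labelResidual, h0]
    norm_num
    ring
  · intro p
    rw [abs_mul]
    exact mul_le_mul (hM _) (abs_labelResidual_le Q p) (abs_nonneg _)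
      ((abs_nonneg _).trans (hM p.1))

/-- Replacing the posterior of the label `1` by the indicator of that label does not change the
expectation. -/
lemma integral_mul_labelIndicator_sub {c e : Z → ℝ} (hc : Measurable c) (he : Measurable e)
    {K : ℝ} (hc1 : ∀ z, |c z| ≤ 1) (heK : ∀ z, |e z| ≤ K) :
    ∫ p, c p.1 * ((if p.2 = 1 then 1 else 0) - e p.1) ∂Q =
      ∫ p, c p.1 * (labelProb Q 1 p.1 - e p.1) ∂Q := by
  have hb : ∀ p : Z × Fin 2, |c p.1 * labelResidual Q p| ≤ 1 := by
    intro p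
    rw [abs_mul]
    exact mul_le_one₀ (hc1 _) (abs_nonneg _) (abs_labelResidual_le Q _)
  have hb2 : ∀ p : Z × Fin 2, |c p.1 * (labelProb Q 1 p.1 - e p.1)| ≤ 1 * (1 + K) := by
    intro p
    rw [abs_mul]
    exact mul_le_mul (hc1 _) (abs_labelProb_sub_le Q _ (heK _)) (abs_nonneg _) zero_le_one
  have i1 : Integrable (fun p : Z × Fin 2 => c p.1 * labelResidual Q p) Q :=
    integrable_of_abs_le ((hc.comp measurable_fst).mul (measurable_labelResidual Q)) hb
  have i2 : Integrable (fun p : Z × Fin 2 => c p.1 * (labelProb Q 1 p.1 - e p.1)) Q :=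
    integrable_of_abs_le ((hc.comp measurable_fst).mul
      (((measurable_labelProb Q 1).comp measurable_fst).sub (he.comp measurable_fst))) hb2
  have h := integral_add i1 i2
  rw [integral_mul_labelResidual Q hc hc1, zero_add] at h
  rw [← h]
  congr 1
  funext p
  simp only [labelResidual]
  ring

lemma bayesError_eq_integral :
    bayesError Q = ∫ p, (1 - max (labelProb Q 0 p.1) (labelProb Q 1 p.1)) ∂Q :=
  integral_fst_eq Q (φ := fun x => 1 - max (labelProb Q 0 x) (labelProb Q 1 x))
    (measurable_const.sub ((measurable_labelProb Q 0).max (measurable_labelProb Q 1)))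

lemma bayesError_mem_Icc [IsProbabilityMeasure Q] : bayesError Q ∈ Set.Icc (0 : ℝ) 1 := by
  rw [bayesError_eq_integral]
  have h := one_sub_max_labelProb_mem_Icc Q
  refine ⟨integral_nonneg fun p => (h p.1).1, ?_⟩
  refine (integral_mono_of_nonneg (Filter.Eventually.of_forall fun p : Z × Fin 2 => (h p.1).1)
    (integrable_const (1 : ℝ)) (Filter.Eventually.of_forall fun p : Z × Fin 2 => (h p.1).2)).trans ?_
  simp

end Label

/-! ### Independent samples -/

section Sample

variable {α : Type*} [MeasurableSpace α] (μ : Measure α) [IsProbabilityMeasure μ]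

lemma integral_pi_insertNth {n : ℕ} (i : Fin (n + 1)) (G : (Fin (n + 1) → α) → ℝ)
    (hG : Measurable G) {M : ℝ} (hM : ∀ T, |G T| ≤ M) :
    ∫ T, G T ∂(Measure.pi fun _ => μ) =
      ∫ S, ∫ p, G (i.insertNth p S) ∂μ ∂(Measure.pi fun _ : Fin n => μ) := by
  have hmp := (measurePreserving_piFinSuccAbove (fun _ : Fin (n + 1) => μ) i).symm
  rw [← hmp.integral_comp' G, integral_prod_symm]
  · rfl
  · exact integrable_of_abs_le (hG.comp (MeasurableEquiv.measurable _)) fun _ => hM _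

lemma integral_pi_perm {ι : Type*} [Fintype ι] (σ : Equiv.Perm ι) (G : (ι → α) → ℝ) :
    ∫ T, G (fun j => T (σ j)) ∂(Measure.pi fun _ : ι => μ) =
      ∫ T, G T ∂(Measure.pi fun _ : ι => μ) := by
  have hmp := measurePreserving_piCongrLeft (fun _ : ι => μ) σ.symm
  rw [← hmp.integral_comp' G]
  congr 1
  funext T
  congr 1
  funext j
  have := MeasurableEquiv.piCongrLeft_apply_apply (β := fun _ : ι => α) σ.symm T (σ j)
  rw [Equiv.symm_apply_apply] at this
  exact this.symm

lemma integral_pi_eval {ι : Type*} [Fintype ι] (i : ι) {φ : α → ℝ} (hφ : Measurable φ) :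
    ∫ T, φ (T i) ∂(Measure.pi fun _ : ι => μ) = ∫ a, φ a ∂μ := by
  have hmp := measurePreserving_eval (fun _ : ι => μ) i
  have h := integral_map (μ := Measure.pi fun _ : ι => μ) (f := φ) hmp.measurable.aemeasurable hφ.aestronglyMeasurable
  rw [hmp.map_eq] at h
  exact h.symm

/-- The residual of the label at one place of the sample is uncorrelated with every quantity that
does not depend on that label. -/
lemma integral_pi_mul_labelResidual {Z : Type*} [MeasurableSpace Z] (Q : Measure (Z × Fin 2))
    [IsProbabilityMeasure Q] {n : ℕ} (i : Fin (n + 1)) (F : (Fin (n + 1) → Z × Fin 2) → ℝ)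
    (hF : Measurable F) {M : ℝ} (hM : ∀ T, |F T| ≤ M)
    (hind : ∀ z y S, F (i.insertNth (z, y) S) = F (i.insertNth (z, 0) S)) :
    ∫ T, F T * labelResidual Q (T i) ∂(Measure.pi fun _ => Q) = 0 := by
  rw [integral_pi_insertNth Q i (fun T => F T * labelResidual Q (T i)) (M := M * 1)]
  · have : ∀ S : Fin n → Z × Fin 2,
        ∫ p, F (i.insertNth p S) * labelResidual Q ((i.insertNth p S : Fin (n + 1) → Z × Fin 2) i)
          ∂Q = 0 := by
      intro S
      rw [← integral_mul_labelResidual Q (c := fun z => F (i.insertNth (z, 0) S)) (M := M) ?_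
        fun _ => hM _]
      · congr 1
        funext p
        rw [Fin.insertNth_apply_same, ← hind p.1 p.2 S]
      · refine hF.comp (measurable_pi_iff.2 fun j => ?_)
        rcases Fin.eq_self_or_eq_succAbove i j with rfl | ⟨l, rfl⟩
        · simp only [Fin.insertNth_apply_same]
          fun_prop
        · simp only [Fin.insertNth_apply_succAbove]
          fun_prop
    simp only [this, integral_zero]
  · exact hF.mul ((measurable_labelResidual Q).comp (measurable_pi_apply i))
  · intro T
    rw [abs_mul]
    exact mul_le_mul (hM _) (abs_labelResidual_le Q _) (abs_nonneg _)
      ((abs_nonneg _).trans (hM T))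

end Sample

/-! ### The nearest neighbour rule on a random sample -/

section Knn

variable {Z : Type*} [PseudoMetricSpace Z] [SecondCountableTopology Z] [MeasurableSpace Z]
  [OpensMeasurableSpace Z] {n : ℕ}

lemma measurable_nnWeight {β : Type*} [MeasurableSpace β] (k : ℕ) {X : β → Fin n → Z}
    (hX : ∀ j, Measurable fun b => X b j) {x : β → Z} (hx : Measurable x) (i : Fin n) :
    Measurable fun b => nnWeight k (X b) (x b) i := by
  have hd : ∀ j, Measurable fun b => dist (x b) (X b j) := fun j => hx.dist (hX j)
  have hr : Measurable fun b => nnRank (X b) (x b) i := by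
    simp only [nnRank, Finset.card_filter]
    refine Finset.measurable_sum _ fun j _ => ?_
    refine Measurable.ite ?_ measurable_const measurable_const
    exact (measurableSet_lt (hd j) (hd i)).union
      ((measurableSet_eq_fun (hd j) (hd i)).inter (MeasurableSet.const _))
  exact Measurable.ite (measurableSet_lt hr measurable_const) measurable_const measurable_const

lemma measurable_knnClassify {β : Type*} [MeasurableSpace β] (k : ℕ) (t : Fin 2)
    {S : β → Fin n → Z × Fin 2} (hS : Measurable S) {x : β → Z} (hx : Measurable x) :
    Measurable fun b => knnClassify k t (S b) (x b) := by
  have hS' : ∀ j, Measurable fun b => S b j := fun j => (measurable_pi_apply j).comp hS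
  have hv : ∀ y, Measurable fun b => (knnVotes k (S b) (x b) y : ℝ) := by
    intro y
    simp only [knnVotes_eq_sum]
    refine Finset.measurable_sum _ fun i _ => ?_
    refine (measurable_nnWeight k (fun j => (hS' j).fst) hx i).mul ?_
    exact Measurable.ite ((hS' i).snd (measurableSet_singleton y)) measurable_const
      measurable_const
  have hlt : ∀ y y', MeasurableSet {b | knnVotes k (S b) (x b) y < knnVotes k (S b) (x b) y'} := by
    intro y y'
    have := measurableSet_lt (hv y) (hv y')
    simpa only [Nat.cast_lt] using this
  exact Measurable.ite (hlt 0 1) measurable_const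
    (Measurable.ite (hlt 1 0) measurable_const measurable_const)

variable (Q : Measure (Z × Fin 2)) [IsProbabilityMeasure Q]

lemma measurable_labelProb_knnClassify {β : Type*} [MeasurableSpace β] (k : ℕ) (t : Fin 2)
    {S : β → Fin n → Z × Fin 2} (hS : Measurable S) {x : β → Z} (hx : Measurable x) :
    Measurable fun b => labelProb Q (knnClassify k t (S b) (x b)) (x b) := by
  have : Measurable fun q : Z × Fin 2 => labelProb Q q.2 q.1 :=
    measurable_from_prod_countable_left fun y => measurable_labelProb Q y
  exact this.comp (hx.prodMk (measurable_knnClassify k t hS hx))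

/-- The test point and the training sample together form a sample of `n + 1` independent points. -/
lemma expectedKnnError_eq_integral (k : ℕ) (t : Fin 2) :
    expectedKnnError Q n k t =
      ∫ T : Fin (n + 1) → Z × Fin 2,
        (1 - labelProb Q (knnClassify k t (fun i : Fin n => T i.succ) (T 0).1) (T 0).1)
          ∂(Measure.pi fun _ => Q) := by
  rw [integral_pi_insertNth Q 0 _ (M := 1)]
  · unfold expectedKnnError
    congr 1
    funext S
    unfold knnError
    rw [integral_eq_integral_labelProb Q (M := 1)]
    · congr 1
      funext p
      simp only [Fin.insertNth_zero', Fin.cons_succ, Fin.cons_zero]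
      have h := labelProb_zero_add_one Q p.1
      generalize knnClassify k t S p.1 = c
      have : c = 0 ∨ c = 1 := by fin_cases c <;> simp
      rcases this with rfl | rfl <;> simp <;> linarith
    · have hc : Measurable fun p : Z × Fin 2 => knnClassify k t S p.1 :=
        measurable_knnClassify k t measurable_const measurable_fst
      exact Measurable.ite (measurableSet_eq_fun hc measurable_snd).compl measurable_const
        measurable_const
    · intro p
      split_ifs <;> simp
  · exact measurable_const.sub (measurable_labelProb_knnClassify Q k t (by fun_prop) (by fun_prop))
  · intro T
    have h0 := labelProb_nonneg Q (knnClassify k t (fun i : Fin n => T i.succ) (T 0).1) (T 0).1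
    have h1 := labelProb_le_one Q (knnClassify k t (fun i : Fin n => T i.succ) (T 0).1) (T 0).1
    rw [abs_le]
    constructor <;> linarith

/-- The weight of the training point `i` in the sample `T`, whose entry `0` is the test point. -/
noncomputable def sampleWeight (k : ℕ) (T : Fin (n + 1) → Z × Fin 2) (i : Fin n) : ℝ :=
  nnWeight k (fun j : Fin n => (T j.succ).1) (T 0).1 i

omit [SecondCountableTopology Z] [MeasurableSpace Z] [OpensMeasurableSpace Z] in
lemma abs_sampleWeight_le (k : ℕ) (T : Fin (n + 1) → Z × Fin 2) (i : Fin n) :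
    |sampleWeight k T i| ≤ 1 := by
  rw [sampleWeight, abs_of_nonneg (nnWeight_nonneg _ _ _ _)]
  exact nnWeight_le_one _ _ _ _

lemma measurable_sampleWeight (k : ℕ) (i : Fin n) :
    Measurable fun T : Fin (n + 1) → Z × Fin 2 => sampleWeight k T i :=
  measurable_nnWeight k (fun j => by fun_prop) (by fun_prop) i

/-- The sum of the label residuals of the `k` nearest neighbours has variance at most `k`, because
given the points the residuals are uncorrelated. -/
lemma integral_sq_sum_labelResidual_le {k : ℕ} (hk : k ≤ n) :
    ∫ T : Fin (n + 1) → Z × Fin 2, (∑ i, sampleWeight k T i * labelResidual Q (T i.succ)) ^ 2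
      ∂(Measure.pi fun _ => Q) ≤ k := by
  have hmw := fun i : Fin n => measurable_sampleWeight (Z := Z) k i
  have hmr : ∀ i : Fin n, Measurable fun T : Fin (n + 1) → Z × Fin 2 =>
      labelResidual Q (T i.succ) := fun i =>
    (measurable_labelResidual Q).comp (measurable_pi_apply _)
  have hb : ∀ (T : Fin (n + 1) → Z × Fin 2) i,
      |sampleWeight k T i * labelResidual Q (T i.succ)| ≤ 1 := by
    intro T i
    rw [abs_mul]
    exact mul_le_one₀ (abs_sampleWeight_le k T i) (abs_nonneg _) (abs_labelResidual_le Q _)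
  have hint : ∀ i j : Fin n, Integrable (fun T : Fin (n + 1) → Z × Fin 2 =>
      (sampleWeight k T i * labelResidual Q (T i.succ)) *
        (sampleWeight k T j * labelResidual Q (T j.succ))) (Measure.pi fun _ => Q) := by
    intro i j
    refine integrable_of_abs_le (((hmw i).mul (hmr i)).mul ((hmw j).mul (hmr j))) (M := 1) ?_
    intro T
    rw [abs_mul]
    exact mul_le_one₀ (hb T i) (abs_nonneg _) (hb T j)
  simp only [sq, Finset.sum_mul_sum]
  rw [integral_finsetSum _ fun i _ => integrable_finsetSum _ fun j _ => hint i j]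
  -- the weights and the residual at `i` do not depend on the label at `j`
  have hoff : ∀ i j : Fin n, j ≠ i → ∫ T : Fin (n + 1) → Z × Fin 2,
      (sampleWeight k T i * labelResidual Q (T i.succ)) *
        (sampleWeight k T j * labelResidual Q (T j.succ)) ∂(Measure.pi fun _ => Q) = 0 := by
    intro i j hji
    rw [← integral_pi_mul_labelResidual Q j.succ (fun T =>
      (sampleWeight k T i * labelResidual Q (T i.succ)) * sampleWeight k T j)
      (((hmw i).mul (hmr i)).mul (hmw j)) (M := 1)]
    · congr 1
      funext T
      ring
    · intro T
      rw [abs_mul]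
      exact mul_le_one₀ (hb T i) (abs_nonneg _) (abs_sampleWeight_le k T j)
    · intro z y S
      have hpt : ∀ l : Fin (n + 1), ((j.succ.insertNth (z, y) S : Fin (n + 1) → Z × Fin 2) l).1 =
          ((j.succ.insertNth (z, 0) S : Fin (n + 1) → Z × Fin 2) l).1 := by
        intro l
        rcases Fin.eq_self_or_eq_succAbove j.succ l with rfl | ⟨m, rfl⟩ <;> simp
      have hi : (j.succ.insertNth (z, y) S : Fin (n + 1) → Z × Fin 2) i.succ =
          (j.succ.insertNth (z, 0) S : Fin (n + 1) → Z × Fin 2) i.succ := by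
        rcases Fin.eq_self_or_eq_succAbove j.succ i.succ with h | ⟨m, hm⟩
        · exact absurd (Fin.succ_injective _ h).symm hji
        · rw [hm]; simp
      simp only [sampleWeight, hpt, hi]
  have hdiag : ∀ i : Fin n, ∫ T : Fin (n + 1) → Z × Fin 2, ∑ j : Fin n,
      (sampleWeight k T i * labelResidual Q (T i.succ)) *
        (sampleWeight k T j * labelResidual Q (T j.succ)) ∂(Measure.pi fun _ => Q) ≤
      ∫ T : Fin (n + 1) → Z × Fin 2, sampleWeight k T i ∂(Measure.pi fun _ => Q) := by
    intro i
    rw [integral_finsetSum _ fun j _ => hint i j,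
      Finset.sum_eq_single i (fun j _ hji => hoff i j hji) (by simp)]
    refine integral_mono (hint i i)
      (integrable_of_abs_le (hmw i) fun T => abs_sampleWeight_le k T i) fun T => ?_
    have h1 : labelResidual Q (T i.succ) ^ 2 ≤ 1 := by
      rw [sq_le_one_iff_abs_le_one]
      exact abs_labelResidual_le Q _
    have h2 : sampleWeight k T i ^ 2 = sampleWeight k T i := nnWeight_sq _ _ _ _
    have h3 : 0 ≤ sampleWeight k T i := nnWeight_nonneg _ _ _ _
    calc (sampleWeight k T i * labelResidual Q (T i.succ)) *
          (sampleWeight k T i * labelResidual Q (T i.succ))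
        = sampleWeight k T i ^ 2 * labelResidual Q (T i.succ) ^ 2 := by ring
      _ ≤ sampleWeight k T i := by
          rw [h2]
          exact mul_le_of_le_one_right h3 h1
  refine (Finset.sum_le_sum fun i _ => hdiag i).trans ?_
  rw [← integral_finsetSum _ fun i _ =>
    integrable_of_abs_le (hmw i) fun T => abs_sampleWeight_le k T i]
  refine le_of_eq ?_
  have : ∀ T : Fin (n + 1) → Z × Fin 2, ∑ i, sampleWeight k T i = k := fun T => sum_nnWeight hk _ _
  simp [this]

lemma integral_abs_sum_labelResidual_le {k : ℕ} (hk : k ≤ n) :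
    ∫ T : Fin (n + 1) → Z × Fin 2, |∑ i, sampleWeight k T i * labelResidual Q (T i.succ)|
      ∂(Measure.pi fun _ => Q) ≤ √k := by
  refine (integral_abs_le_sqrt (M := n) ?_ ?_).trans
    (Real.sqrt_le_sqrt (integral_sq_sum_labelResidual_le Q hk))
  · exact Finset.measurable_sum _ fun i _ => (measurable_sampleWeight k i).mul
      ((measurable_labelResidual Q).comp (measurable_pi_apply _))
  · intro T
    refine (Finset.abs_sum_le_sum_abs _ _).trans ?_
    refine (Finset.sum_le_card_nsmul _ _ 1 fun i _ => ?_).trans (by simp)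
    rw [abs_mul]
    exact mul_le_one₀ (abs_sampleWeight_le k T i) (abs_nonneg _) (abs_labelResidual_le Q _)

/-- The consequence of Stone's lemma: trading places between the test point and a training point
shows that averages over the nearest neighbours are controlled by averages over the test point. -/
lemma integral_sum_sampleWeight_mul_le {k : ℕ} {γ : ℝ}
    (hγ : ∀ (X : Fin n → Z) (x : Z), ∑ i, nnWeight k (Function.update X i x) (X i) i ≤ γ * k)
    {h : Z → ℝ} (hm : Measurable h) (h0 : ∀ z, 0 ≤ h z) {M : ℝ} (hM : ∀ z, h z ≤ M) :
    ∫ T : Fin (n + 1) → Z × Fin 2, ∑ i, sampleWeight k T i * h (T i.succ).1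
      ∂(Measure.pi fun _ => Q) ≤ γ * k * ∫ p, h p.1 ∂Q := by
  have hM' : ∀ z, |h z| ≤ M := fun z => by rw [abs_of_nonneg (h0 z)]; exact hM z
  have hme : ∀ l : Fin (n + 1), Measurable fun T : Fin (n + 1) → Z × Fin 2 => h (T l).1 :=
    fun l => hm.comp (by fun_prop)
  have hpt : ∀ i : Fin n, ∫ T : Fin (n + 1) → Z × Fin 2, sampleWeight k T i * h (T i.succ).1
        ∂(Measure.pi fun _ => Q) =
      ∫ T : Fin (n + 1) → Z × Fin 2, nnWeight k (Function.update (fun j : Fin n => (T j.succ).1) i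
        (T 0).1) (T i.succ).1 i * h (T 0).1 ∂(Measure.pi fun _ => Q) := by
    intro i
    rw [← integral_pi_perm Q (Equiv.swap 0 i.succ)]
    congr 1
    funext T
    have hX : (fun j : Fin n => (T (Equiv.swap 0 i.succ j.succ)).1) =
        Function.update (fun j : Fin n => (T j.succ).1) i (T 0).1 := by
      funext j
      by_cases hji : j = i
      · subst hji
        simp
      · rw [Function.update_of_ne hji,
          Equiv.swap_apply_of_ne_of_ne (Fin.succ_ne_zero j) fun h => hji (Fin.succ_injective _ h)]
    simp only [sampleWeight, Equiv.swap_apply_left, Equiv.swap_apply_right]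
    rw [hX]
  have hmu : ∀ i : Fin n, Measurable fun T : Fin (n + 1) → Z × Fin 2 =>
      nnWeight k (Function.update (fun j : Fin n => (T j.succ).1) i (T 0).1) (T i.succ).1 i := by
    intro i
    refine measurable_nnWeight k (fun j => ?_) (by fun_prop) i
    by_cases hji : j = i
    · subst hji
      simp only [Function.update_self]
      fun_prop
    · simp only [Function.update_of_ne hji]
      fun_prop
  have hb : ∀ a b : ℝ, 0 ≤ a → a ≤ 1 → |b| ≤ M → |a * b| ≤ M := by
    intro a b h1 h2 h3
    rw [abs_mul, abs_of_nonneg h1]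
    exact (mul_le_of_le_one_left (abs_nonneg _) h2).trans h3
  have i1 : ∀ i : Fin n, Integrable (fun T : Fin (n + 1) → Z × Fin 2 =>
      sampleWeight k T i * h (T i.succ).1) (Measure.pi fun _ => Q) := fun i =>
    integrable_of_abs_le ((measurable_sampleWeight k i).mul (hme _))
      fun T => hb _ _ (nnWeight_nonneg _ _ _ _) (nnWeight_le_one _ _ _ _) (hM' _)
  have i2 : ∀ i : Fin n, Integrable (fun T : Fin (n + 1) → Z × Fin 2 =>
      nnWeight k (Function.update (fun j : Fin n => (T j.succ).1) i (T 0).1) (T i.succ).1 i *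
        h (T 0).1) (Measure.pi fun _ => Q) := fun i =>
    integrable_of_abs_le ((hmu i).mul (hme 0))
      fun T => hb _ _ (nnWeight_nonneg _ _ _ _) (nnWeight_le_one _ _ _ _) (hM' _)
  rw [integral_finsetSum _ fun i _ => i1 i, Finset.sum_congr rfl fun i _ => hpt i,
    ← integral_finsetSum _ fun i _ => i2 i,
    ← integral_pi_eval Q (0 : Fin (n + 1)) (φ := fun p => h p.1) (hm.comp measurable_fst),
    ← integral_const_mul]
  refine integral_mono (integrable_finsetSum _ fun i _ => i2 i)
    ((integrable_of_abs_le (hme 0) fun T => hM' _).const_mul _) fun T => ?_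
  rw [← Finset.sum_mul]
  exact mul_le_mul_of_nonneg_right (hγ _ _) (h0 _)

lemma measurable_nnMeanDist {β : Type*} [MeasurableSpace β] (k : ℕ) {X : β → Fin n → Z}
    (hX : ∀ j, Measurable fun b => X b j) {x : β → Z} (hx : Measurable x) :
    Measurable fun b => nnMeanDist k (X b) (x b) :=
  (Finset.measurable_sum _ fun i _ =>
    (measurable_nnWeight k hX hx i).mul (hx.dist (hX i))).div_const _

/-- By exchangeability the expected mean distance at the test point is the expectation of its
average over all choices of the test point among `n + 1` points. -/
lemma integral_nnMeanDist_le {k : ℕ} (hk0 : 1 ≤ k) (hk : k ≤ n) {M C : ℝ}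
    (hM : ∀ z w : Z, dist z w ≤ M)
    (hC : ∀ z : Fin (n + 1) → Z, (∑ j, nnMeanDist k (fun i : Fin n => z (Equiv.swap 0 j i.succ))
      (z (Equiv.swap 0 j 0))) / (n + 1) ≤ C) :
    ∫ T : Fin (n + 1) → Z × Fin 2, nnMeanDist k (fun i : Fin n => (T i.succ).1) (T 0).1
      ∂(Measure.pi fun _ => Q) ≤ C := by
  set I := ∫ T : Fin (n + 1) → Z × Fin 2, nnMeanDist k (fun i : Fin n => (T i.succ).1) (T 0).1
      ∂(Measure.pi fun _ => Q) with hI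
  let G : Fin (n + 1) → (Fin (n + 1) → Z × Fin 2) → ℝ := fun j T =>
    nnMeanDist k (fun i : Fin n => (T (Equiv.swap 0 j i.succ)).1) (T (Equiv.swap 0 j 0)).1
  have hint : ∀ j, Integrable (G j) (Measure.pi fun _ => Q) := by
    intro j
    refine integrable_of_abs_le (M := M)
      (measurable_nnMeanDist k (fun _ => by fun_prop) (by fun_prop)) fun T => ?_
    rw [abs_of_nonneg (nnMeanDist_nonneg _ _ _)]
    exact nnMeanDist_le hk0 hk _ _ fun i => hM _ _
  have hj : ∀ j, ∫ T, G j T ∂(Measure.pi fun _ => Q) = I := fun j =>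
    integral_pi_perm Q (Equiv.swap 0 j) fun T : Fin (n + 1) → Z × Fin 2 =>
      nnMeanDist k (fun i : Fin n => (T i.succ).1) (T 0).1
  have hsum : ∫ T, (∑ j, G j T) / (n + 1) ∂(Measure.pi fun _ => Q) = I := by
    rw [integral_div, integral_finsetSum _ fun j _ => hint j]
    simp only [hj, Finset.sum_const, Finset.card_univ, Fintype.card_fin, nsmul_eq_mul]
    push_cast
    field_simp
  rw [← hsum]
  refine (integral_mono ((integrable_finsetSum _ fun j _ => hint j).div_const _)
    (integrable_const C) fun T => hC fun l => (T l).1).trans ?_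
  simp

omit [SecondCountableTopology Z] [OpensMeasurableSpace Z] in
/-- The excess risk of the nearest neighbour rule on a fixed sample. The four terms are the noise
of the labels, the distance of the posterior from `g` at the neighbours and at the test point, and
the variation of `g` between these points. -/
lemma max_sub_labelProb_knnClassify_le {k : ℕ} (hk0 : 1 ≤ k) (hk : k ≤ n) (t : Fin 2) {L : ℝ≥0}
    {g : Z → ℝ} (hg : LipschitzWith L g) (T : Fin (n + 1) → Z × Fin 2) :
    max (labelProb Q 0 (T 0).1) (labelProb Q 1 (T 0).1)
      - labelProb Q (knnClassify k t (fun i : Fin n => T i.succ) (T 0).1) (T 0).1 ≤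
    2 / k * |∑ i, sampleWeight k T i * labelResidual Q (T i.succ)|
      + 2 / k * ∑ i, sampleWeight k T i * |labelProb Q 1 (T i.succ).1 - g (T i.succ).1|
      + 2 * L * nnMeanDist k (fun i : Fin n => (T i.succ).1) (T 0).1
      + 2 * |labelProb Q 1 (T 0).1 - g (T 0).1| := by
  have hk' : (0 : ℝ) < k := by exact_mod_cast hk0
  refine (max_sub_knnClassify_le hk0 hk t (fun i : Fin n => T i.succ) (T 0).1
    (fun y => labelProb Q y (T 0).1) (labelProb_zero_add_one Q _)).trans ?_
  set x := (T 0).1 with hx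
  set v := (knnVotes k (fun i : Fin n => T i.succ) x 1 : ℝ) with hv
  have hw := sum_nnWeight hk (fun i : Fin n => (T i.succ).1) x
  have hdec : v / k - labelProb Q 1 x =
      (∑ i, sampleWeight k T i * labelResidual Q (T i.succ)) / k
      + (∑ i, sampleWeight k T i * ((labelProb Q 1 (T i.succ).1 - g (T i.succ).1)
          + (g (T i.succ).1 - g x))) / k + (g x - labelProb Q 1 x) := by
    have h1 : v = ∑ i, sampleWeight k T i * labelResidual Q (T i.succ)
        + ∑ i, sampleWeight k T i * ((labelProb Q 1 (T i.succ).1 - g (T i.succ).1)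
          + (g (T i.succ).1 - g x)) + k * g x := by
      rw [hv, knnVotes_eq_sum, ← hw, Finset.sum_mul, ← Finset.sum_add_distrib,
        ← Finset.sum_add_distrib]
      refine Finset.sum_congr rfl fun i _ => ?_
      simp only [sampleWeight, labelResidual, ← hx]
      ring
    rw [h1]
    field_simp
    ring
  have hmid : |∑ i, sampleWeight k T i * ((labelProb Q 1 (T i.succ).1 - g (T i.succ).1)
      + (g (T i.succ).1 - g x))| ≤
      ∑ i, sampleWeight k T i * |labelProb Q 1 (T i.succ).1 - g (T i.succ).1|
        + L * ∑ i, sampleWeight k T i * dist x (T i.succ).1 := by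
    rw [Finset.mul_sum, ← Finset.sum_add_distrib]
    refine (Finset.abs_sum_le_sum_abs _ _).trans (Finset.sum_le_sum fun i _ => ?_)
    have hw0 : 0 ≤ sampleWeight k T i := nnWeight_nonneg _ _ _ _
    rw [abs_mul, abs_of_nonneg hw0]
    have h1 := hg.dist_le_mul (T i.succ).1 x
    rw [Real.dist_eq, dist_comm] at h1
    calc sampleWeight k T i * |_ + (g (T i.succ).1 - g x)|
        ≤ sampleWeight k T i * (|labelProb Q 1 (T i.succ).1 - g (T i.succ).1|
          + L * dist x (T i.succ).1) :=
          mul_le_mul_of_nonneg_left ((abs_add_le _ _).trans (by gcongr)) hw0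
      _ = _ := by ring
  rw [hdec]
  refine (mul_le_mul_of_nonneg_left (abs_add_three _ _ _) zero_le_two).trans ?_
  rw [abs_div, abs_div, abs_of_pos hk', abs_sub_comm (g x)]
  have h2 := div_le_div_of_nonneg_right hmid hk'.le
  have h3 : nnMeanDist k (fun i : Fin n => (T i.succ).1) x =
      (∑ i, sampleWeight k T i * dist x (T i.succ).1) / k := rfl
  rw [h3]
  calc _ ≤ 2 * (|∑ i, sampleWeight k T i * labelResidual Q (T i.succ)| / k
      + (∑ i, sampleWeight k T i * |labelProb Q 1 (T i.succ).1 - g (T i.succ).1|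
        + L * ∑ i, sampleWeight k T i * dist x (T i.succ).1) / k
      + |labelProb Q 1 x - g x|) := by gcongr
    _ = _ := by ring

lemma expectedKnnError_mem_Icc (k : ℕ) (t : Fin 2) :
    expectedKnnError Q n k t ∈ Set.Icc (0 : ℝ) 1 := by
  rw [expectedKnnError_eq_integral]
  refine ⟨integral_nonneg fun T => sub_nonneg.2 (labelProb_le_one Q _ _), ?_⟩
  refine (integral_mono_of_nonneg (Filter.Eventually.of_forall fun T =>
    sub_nonneg.2 (labelProb_le_one Q _ _)) (integrable_const (1 : ℝ))
    (Filter.Eventually.of_forall fun T => sub_le_self _ (labelProb_nonneg Q _ _))).trans ?_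
  simp

/-- The excess risk of the nearest neighbour rule when the posterior is close in mean to a Lipschitz
function. -/
lemma abs_expectedKnnError_sub_bayesError_le {k : ℕ} (hk0 : 1 ≤ k) (hk : k ≤ n) (t : Fin 2)
    {γ M C : ℝ}
    (hγ : ∀ (X : Fin n → Z) (x : Z), ∑ i, nnWeight k (Function.update X i x) (X i) i ≤ γ * k)
    (hM : ∀ z w : Z, dist z w ≤ M)
    (hC : ∀ z : Fin (n + 1) → Z, (∑ j, nnMeanDist k (fun i : Fin n => z (Equiv.swap 0 j i.succ))
      (z (Equiv.swap 0 j 0))) / (n + 1) ≤ C)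
    {L : ℝ≥0} {g : Z → ℝ} (hg : LipschitzWith L g) (hgm : Measurable g) {K : ℝ}
    (hK : ∀ z, |g z| ≤ K) :
    |expectedKnnError Q n k t - bayesError Q| ≤
      2 * (1 / √k) + 2 * L * C + 2 * (γ + 1) * ∫ p, |labelProb Q 1 p.1 - g p.1| ∂Q := by
  have hk' : (0 : ℝ) < k := by exact_mod_cast hk0
  have hpm : ∀ y, Measurable (labelProb Q y) := measurable_labelProb Q
  have h0 : ∀ y x, 0 ≤ labelProb Q y x := labelProb_nonneg Q
  have h1 : ∀ y x, labelProb Q y x ≤ 1 := labelProb_le_one Q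
  set h : Z → ℝ := fun z => |labelProb Q 1 z - g z| with hh
  have hhm : Measurable h := ((hpm 1).sub hgm).abs
  have hh0 : ∀ z, 0 ≤ h z := fun z => abs_nonneg _
  have hhb : ∀ z, h z ≤ 1 + K := fun z => (abs_sub _ _).trans
    (add_le_add ((abs_of_nonneg (h0 1 z)).le.trans (h1 1 z)) (hK z))
  set Ω := Measure.pi fun _ : Fin (n + 1) => Q with hΩ
  let b : (Fin (n + 1) → Z × Fin 2) → ℝ := fun T =>
    max (labelProb Q 0 (T 0).1) (labelProb Q 1 (T 0).1)
  let c : (Fin (n + 1) → Z × Fin 2) → ℝ := fun T =>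
    labelProb Q (knnClassify k t (fun i : Fin n => T i.succ) (T 0).1) (T 0).1
  have hcm : Measurable c := measurable_labelProb_knnClassify Q k t (by fun_prop) (by fun_prop)
  have hbm : Measurable b :=
    ((hpm 0).comp (by fun_prop)).max ((hpm 1).comp (by fun_prop))
  have hci : Integrable c Ω := integrable_of_abs_le hcm (M := 1) fun T => by
    rw [abs_of_nonneg (h0 _ _)]; exact h1 _ _
  have hbi : Integrable b Ω := integrable_of_abs_le hbm (M := 1) fun T => by
    rw [abs_of_nonneg (le_max_of_le_left (h0 _ _))]; exact max_le (h1 _ _) (h1 _ _)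
  have hci' : Integrable (fun T => 1 - c T) Ω := (integrable_const _).sub hci
  have hbi' : Integrable (fun T => 1 - b T) Ω := (integrable_const _).sub hbi
  have hdiff : expectedKnnError Q n k t - bayesError Q = ∫ T, (b T - c T) ∂Ω := by
    rw [expectedKnnError_eq_integral, bayesError_eq_integral,
      ← integral_pi_eval Q (0 : Fin (n + 1))
        (φ := fun p => 1 - max (labelProb Q 0 p.1) (labelProb Q 1 p.1)),
      ← integral_sub hci' hbi']
    · congr 1
      funext T
      simp only [b, c]
      ring
    · exact measurable_const.sub
        (((hpm 0).comp measurable_fst).max ((hpm 1).comp measurable_fst))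
  have hnn : 0 ≤ ∫ T, (b T - c T) ∂Ω := by
    refine integral_nonneg fun T => sub_nonneg.2 ?_
    simp only [b, c]
    generalize knnClassify k t (fun i : Fin n => T i.succ) (T 0).1 = y
    have : y = 0 ∨ y = 1 := by fin_cases y <;> simp
    rcases this with rfl | rfl
    · exact le_max_left _ _
    · exact le_max_right _ _
  rw [hdiff, abs_of_nonneg hnn]
  have hmh : ∀ l : Fin (n + 1), Measurable fun T : Fin (n + 1) → Z × Fin 2 => h (T l).1 :=
    fun l => hhm.comp (by fun_prop)
  have hr : ∀ (T : Fin (n + 1) → Z × Fin 2) (i : Fin n),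
      |sampleWeight k T i * labelResidual Q (T i.succ)| ≤ 1 := by
    intro T i
    rw [abs_mul]
    exact mul_le_one₀ (abs_sampleWeight_le k T i) (abs_nonneg _) (abs_labelResidual_le Q _)
  have i1 : Integrable (fun T => |∑ i, sampleWeight k T i * labelResidual Q (T i.succ)|) Ω := by
    refine (integrable_finsetSum _ fun i _ => integrable_of_abs_le (M := 1) ?_ fun T => hr T i).abs
    exact (measurable_sampleWeight k i).mul
      ((measurable_labelResidual Q).comp (measurable_pi_apply _))
  have i2 : Integrable (fun T => ∑ i, sampleWeight k T i * h (T i.succ).1) Ω := by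
    refine integrable_finsetSum _ fun i _ => integrable_of_abs_le (M := 1 * (1 + K))
      ((measurable_sampleWeight k i).mul (hmh _)) fun T => ?_
    rw [abs_mul, abs_of_nonneg (hh0 _)]
    exact mul_le_mul (abs_sampleWeight_le k T i) (hhb _) (hh0 _) zero_le_one
  have i3 : Integrable (fun T : Fin (n + 1) → Z × Fin 2 =>
      nnMeanDist k (fun i : Fin n => (T i.succ).1) (T 0).1) Ω := by
    refine integrable_of_abs_le (M := M)
      (measurable_nnMeanDist k (fun _ => by fun_prop) (by fun_prop)) fun T => ?_
    rw [abs_of_nonneg (nnMeanDist_nonneg _ _ _)]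
    exact nnMeanDist_le hk0 hk _ _ fun i => hM _ _
  have i4 : Integrable (fun T : Fin (n + 1) → Z × Fin 2 => h (T 0).1) Ω :=
    integrable_of_abs_le (hmh 0) fun T => by rw [abs_of_nonneg (hh0 _)]; exact hhb _
  have j1 := i1.const_mul (2 / (k : ℝ))
  have j12 : Integrable (fun T : Fin (n + 1) → Z × Fin 2 =>
      2 / (k : ℝ) * |∑ i, sampleWeight k T i * labelResidual Q (T i.succ)|
        + 2 / k * ∑ i, sampleWeight k T i * h (T i.succ).1) Ω := j1.add (i2.const_mul _)
  have j123 : Integrable (fun T : Fin (n + 1) → Z × Fin 2 =>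
      2 / (k : ℝ) * |∑ i, sampleWeight k T i * labelResidual Q (T i.succ)|
        + 2 / k * ∑ i, sampleWeight k T i * h (T i.succ).1
        + 2 * L * nnMeanDist k (fun i : Fin n => (T i.succ).1) (T 0).1) Ω :=
    j12.add (i3.const_mul _)
  refine (integral_mono (hbi.sub hci) (j123.add (i4.const_mul 2))
    (fun T => max_sub_labelProb_knnClassify_le Q hk0 hk t hg T)).trans ?_
  rw [integral_add' j123 (i4.const_mul _), integral_add j12 (i3.const_mul _),
    integral_add j1 (i2.const_mul _), integral_const_mul, integral_const_mul,
    integral_const_mul, integral_const_mul]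
  have e1 := integral_abs_sum_labelResidual_le Q hk
  have e2 := integral_sum_sampleWeight_mul_le Q hγ hhm hh0 hhb
  have e3 := integral_nnMeanDist_le Q hk0 hk hM hC
  have e4 := integral_pi_eval Q (0 : Fin (n + 1)) (φ := fun p => h p.1) (hhm.comp measurable_fst)
  rw [← hΩ] at e1 e2 e3 e4
  rw [e4]
  have hsq : 2 / (k : ℝ) * √k = 2 * (1 / √k) := by
    have h5 : √(k : ℝ) * √k = k := Real.mul_self_sqrt hk'.le
    have h6 : √(k : ℝ) ≠ 0 := (Real.sqrt_pos.2 hk').ne'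
    field_simp
    linarith
  calc _ ≤ 2 / (k : ℝ) * √k + 2 / k * (γ * k * ∫ p, h p.1 ∂Q) + 2 * L * C
        + 2 * ∫ p, h p.1 ∂Q := by gcongr
    _ = _ := by
      rw [hsq]
      field_simp
      ring

end Knn

/-! ### Transformed data -/

section Transform

variable {Z W : Type*} [MeasurableSpace Z] [MeasurableSpace W] (P : Measure (Z × Fin 2))
  [IsProbabilityMeasure P] {f : Z → W}

lemma isProbabilityMeasure_transformedLaw (hf : Measurable f) :
    IsProbabilityMeasure (transformedLaw P f) :=
  Measure.isProbabilityMeasure_map (by fun_prop)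

omit [IsProbabilityMeasure P] in
lemma integral_transformedLaw (hf : Measurable f) {φ : W × Fin 2 → ℝ} (hφ : Measurable φ) :
    ∫ q, φ q ∂(transformedLaw P f) = ∫ p, φ (f p.1, p.2) ∂P :=
  integral_map (by fun_prop) hφ.aestronglyMeasurable

/-- Passing from the data to the transformed data averages the posterior, and this does not
increase the mean distance from a function of the transformed data. -/
lemma integral_abs_labelProb_transformedLaw_sub_le (hf : Measurable f) {g : W → ℝ}
    (hg : Measurable g) {K : ℝ} (hK : ∀ z, |g z| ≤ K) :
    ∫ q, |labelProb (transformedLaw P f) 1 q.1 - g q.1| ∂(transformedLaw P f) ≤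
      ∫ p, |labelProb P 1 p.1 - g (f p.1)| ∂P := by
  have := isProbabilityMeasure_transformedLaw P hf
  set Q := transformedLaw P f with hQ
  have hpm := measurable_labelProb Q 1
  -- the sign of the difference, a function of the transformed point alone
  let s : W → ℝ := fun z => if 0 ≤ labelProb Q 1 z - g z then 1 else -1
  have hs : Measurable s :=
    Measurable.ite (measurableSet_le measurable_const (hpm.sub hg)) measurable_const
      measurable_const
  have hs1 : ∀ z, |s z| ≤ 1 := by
    intro z
    simp only [s]
    split_ifs <;> simp
  have habs : ∀ z, |labelProb Q 1 z - g z| = s z * (labelProb Q 1 z - g z) := by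
    intro z
    simp only [s]
    split_ifs with h
    · rw [abs_of_nonneg h, one_mul]
    · rw [abs_of_neg (not_le.1 h), neg_one_mul]
  calc ∫ q, |labelProb Q 1 q.1 - g q.1| ∂Q
      = ∫ q, s q.1 * (labelProb Q 1 q.1 - g q.1) ∂Q := by simp only [habs]
    _ = ∫ q, s q.1 * ((if q.2 = 1 then 1 else 0) - g q.1) ∂Q := 
        (integral_mul_labelIndicator_sub Q hs hg hs1 hK).symm
    _ = ∫ p, s (f p.1) * ((if p.2 = 1 then 1 else 0) - g (f p.1)) ∂P := by
        refine integral_transformedLaw P hf (φ := fun q => s q.1 * ((if q.2 = 1 then 1 else 0)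
          - g q.1)) ?_
        refine (hs.comp measurable_fst).mul (Measurable.sub ?_ (hg.comp measurable_fst))
        exact Measurable.ite (measurable_snd (measurableSet_singleton 1)) measurable_const
          measurable_const
    _ = ∫ p, s (f p.1) * (labelProb P 1 p.1 - g (f p.1)) ∂P :=
        integral_mul_labelIndicator_sub P (c := s ∘ f) (e := g ∘ f) (hs.comp hf) (hg.comp hf)
          (fun _ => hs1 _) fun _ => hK _
    _ ≤ ∫ p, |labelProb P 1 p.1 - g (f p.1)| ∂P := by
        have hle : ∀ p : Z × Fin 2, |s (f p.1) * (labelProb P 1 p.1 - g (f p.1))| ≤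
            |labelProb P 1 p.1 - g (f p.1)| := fun p => by
          rw [abs_mul]
          exact mul_le_of_le_one_left (abs_nonneg _) (hs1 _)
        have hd : Measurable fun p : Z × Fin 2 => labelProb P 1 p.1 - g (f p.1) :=
          ((measurable_labelProb P 1).comp measurable_fst).sub
            ((hg.comp hf).comp measurable_fst)
        have hdK := fun p : Z × Fin 2 => abs_labelProb_sub_le P p.1 (hK (f p.1))
        refine integral_mono (integrable_of_abs_le (((hs.comp hf).comp measurable_fst).mul hd)
          fun p => (hle p).trans (hdK p)) (integrable_of_abs_le hd hdK).abs
          fun p => (le_abs_self _).trans (hle p)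

/-- The Bayes errors of the data and of the transformed data. -/
lemma abs_bayesError_transformedLaw_sub_le (hf : Measurable f) {g : W → ℝ} (hg : Measurable g)
    {K : ℝ} (hK : ∀ z, |g z| ≤ K) :
    |bayesError (transformedLaw P f) - bayesError P| ≤
      2 * ∫ p, |labelProb P 1 p.1 - g (f p.1)| ∂P := by
  have := isProbabilityMeasure_transformedLaw P hf
  have hcontr := integral_abs_labelProb_transformedLaw_sub_le P hf hg hK
  set Q := transformedLaw P f with hQ
  have hQm : ∀ y, Measurable fun p : Z × Fin 2 => labelProb Q y (f p.1) := fun y =>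
    (measurable_labelProb Q y).comp (hf.comp measurable_fst)
  have hPm : ∀ y, Measurable fun p : Z × Fin 2 => labelProb P y p.1 := fun y =>
    (measurable_labelProb P y).comp measurable_fst
  have hgm : Measurable fun p : Z × Fin 2 => g (f p.1) := hg.comp (hf.comp measurable_fst)
  have hbQ : ∀ p : Z × Fin 2, |1 - max (labelProb Q 0 (f p.1)) (labelProb Q 1 (f p.1))| ≤ 1 :=
    fun p => abs_one_sub_max_labelProb_le Q _
  have hbP : ∀ p : Z × Fin 2, |1 - max (labelProb P 0 p.1) (labelProb P 1 p.1)| ≤ 1 :=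
    fun p => abs_one_sub_max_labelProb_le P _
  have iQ : Integrable (fun p : Z × Fin 2 =>
      1 - max (labelProb Q 0 (f p.1)) (labelProb Q 1 (f p.1))) P :=
    integrable_of_abs_le (measurable_const.sub ((hQm 0).max (hQm 1))) hbQ
  have iP : Integrable (fun p : Z × Fin 2 => 1 - max (labelProb P 0 p.1) (labelProb P 1 p.1)) P :=
    integrable_of_abs_le (measurable_const.sub ((hPm 0).max (hPm 1))) hbP
  have iQg : Integrable (fun p : Z × Fin 2 => |labelProb Q 1 (f p.1) - g (f p.1)|) P :=
    (integrable_of_abs_le ((hQm 1).sub hgm) fun p => abs_labelProb_sub_le Q _ (hK _)).abs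
  have iPg : Integrable (fun p : Z × Fin 2 => |labelProb P 1 p.1 - g (f p.1)|) P :=
    (integrable_of_abs_le ((hPm 1).sub hgm) fun p => abs_labelProb_sub_le P _ (hK _)).abs
  have hpt : ∀ p : Z × Fin 2, |(1 - max (labelProb Q 0 (f p.1)) (labelProb Q 1 (f p.1)))
      - (1 - max (labelProb P 0 p.1) (labelProb P 1 p.1))| ≤
      |labelProb Q 1 (f p.1) - g (f p.1)| + |labelProb P 1 p.1 - g (f p.1)| := by
    intro p
    have h1 := abs_max_sub_max_le_max (labelProb P 0 p.1) (labelProb P 1 p.1)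
      (labelProb Q 0 (f p.1)) (labelProb Q 1 (f p.1))
    have h2 : labelProb P 0 p.1 - labelProb Q 0 (f p.1) =
        -(labelProb P 1 p.1 - labelProb Q 1 (f p.1)) := by
      linarith [labelProb_zero_add_one P p.1, labelProb_zero_add_one Q (f p.1)]
    rw [h2, abs_neg, max_self] at h1
    have h3 := abs_sub_le (labelProb P 1 p.1) (g (f p.1)) (labelProb Q 1 (f p.1))
    rw [abs_sub_comm (g (f p.1))] at h3
    rw [sub_sub_sub_cancel_left]
    linarith
  have hQg : ∫ q, |labelProb Q 1 q.1 - g q.1| ∂Q =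
      ∫ p, |labelProb Q 1 (f p.1) - g (f p.1)| ∂P :=
    integral_transformedLaw P hf (φ := fun q => |labelProb Q 1 q.1 - g q.1|)
      (((measurable_labelProb Q 1).sub hg).comp measurable_fst).abs
  have hbay : bayesError Q =
      ∫ p, (1 - max (labelProb Q 0 (f p.1)) (labelProb Q 1 (f p.1))) ∂P := by
    rw [bayesError_eq_integral]
    exact integral_transformedLaw P hf
      (φ := fun q => 1 - max (labelProb Q 0 q.1) (labelProb Q 1 q.1))
      ((measurable_const.sub ((measurable_labelProb Q 0).max
        (measurable_labelProb Q 1))).comp measurable_fst)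
  rw [hbay, bayesError_eq_integral P, ← integral_sub iQ iP]
  calc _ ≤ ∫ p, (|labelProb Q 1 (f p.1) - g (f p.1)| + |labelProb P 1 p.1 - g (f p.1)|) ∂P :=
        (abs_integral_le_integral_abs).trans (integral_mono (iQ.sub iP).abs (iQg.add iPg) hpt)
    _ = ∫ q, |labelProb Q 1 q.1 - g q.1| ∂Q + ∫ p, |labelProb P 1 p.1 - g (f p.1)| ∂P := by
        rw [integral_add iQg iPg, hQg]
    _ ≤ _ := by linarith

lemma integral_abs_labelProb_sub_le_sqrt_squaredLoss (hf : Measurable f) {g : W → ℝ}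
    (hg : Measurable g) {K : ℝ} (hK : ∀ z, |g z| ≤ K) :
    ∫ p, |labelProb P 1 p.1 - g (f p.1)| ∂P ≤ √(squaredLoss P g f) := by
  have hm : Measurable fun x => labelProb P 1 x - g (f x) :=
    (measurable_labelProb P 1).sub (hg.comp hf)
  have h := integral_abs_le_sqrt (μ := P) (φ := fun p => labelProb P 1 p.1 - g (f p.1))
    (hm.comp measurable_fst) fun p => abs_labelProb_sub_le P p.1 (hK (f p.1))
  refine h.trans (le_of_eq ?_)
  rw [squaredLoss, ← integral_fst_eq P (φ := fun x => (labelProb P 1 x - g (f x)) ^ 2)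
    (hm.pow_const 2)]
  congr 2
  funext x
  ring

end Transform

/-! ### The risk bound -/

/-- A quantity bounded both by `1` and by a multiple of `√x` is bounded by a multiple of the fourth
root of `x`. -/
lemma le_rpow_quarter_of_le_sqrt {a b c x : ℝ} (hx : 0 ≤ x) (hb : 0 ≤ b) (hc : 1 ≤ c)
    (ha1 : a ≤ 1) (ha : a ≤ b + c * √x) : a ≤ b + c * x ^ (1 / 4 : ℝ) := by
  rcases le_total x 1 with h | h
  · have : √x ≤ x ^ (1 / 4 : ℝ) := by
      rw [Real.sqrt_eq_rpow]
      exact Real.rpow_le_rpow_of_exponent_ge_of_imp hx h (by norm_num) (by intro; norm_num)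
    nlinarith
  · have := Real.one_le_rpow h (by norm_num : (0 : ℝ) ≤ 1 / 4)
    nlinarith

theorem mainTheorem1 (d : ℕ) (hd : 1 ≤ d) (𝒳' : Set (EuclideanSpace ℝ (Fin d)))
    (h𝒳' : Bornology.IsBounded 𝒳') :
    ∃ C₁ C₂ C₃ : ℝ, 0 < C₁ ∧ 0 < C₂ ∧ 0 < C₃ ∧
      ∀ (D : ℕ) (𝒳 : Set (EuclideanSpace ℝ (Fin D))), Bornology.IsBounded 𝒳 →
      ∀ (P : Measure (𝒳 × Fin 2)) [IsProbabilityMeasure P]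
        (L : ℝ≥0) (g : 𝒳' → ℝ), LipschitzWith L g →
      ∀ f : 𝒳 → 𝒳', Measurable f →
      ∀ n k : ℕ, 1 ≤ k → k ≤ n → ∀ t : Fin 2,
        |expectedKnnError (transformedLaw P f) n k t - bayesError P| ≤
          C₁ * (1 / √(k : ℝ))
            + C₂ * ((L : ℝ) * ((k : ℝ) / (n : ℝ)) ^ (1 / (d : ℝ)))
            + C₃ * squaredLoss P g f ^ (1 / 4 : ℝ) := by
  obtain ⟨γ, hγ0, hγ⟩ := exists_sum_nnWeight_update_le 𝒳'
  obtain ⟨B, hB, hA⟩ := h𝒳'.exists_pos_norm_le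
  refine ⟨2, 8 * B, 2 * γ + 4, by norm_num, by positivity, by positivity, ?_⟩
  intro D 𝒳 _ P _ L g hg f hf n k hk0 hk t
  have hQ := isProbabilityMeasure_transformedLaw P hf
  have hgm : Measurable g := hg.continuous.measurable
  have hdist : ∀ z w : 𝒳', dist z w ≤ 2 * B := by
    intro z w
    rw [Subtype.dist_eq, dist_eq_norm]
    linarith [norm_sub_le (z : EuclideanSpace ℝ (Fin d)) w, hA _ z.2, hA _ w.2]
  obtain ⟨K, hK⟩ : ∃ K, ∀ z, |g z| ≤ K := by
    rcases isEmpty_or_nonempty 𝒳' with h | ⟨⟨z₀⟩⟩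
    · exact ⟨0, fun z => h.elim z⟩
    · refine ⟨|g z₀| + L * (2 * B), fun z => ?_⟩
      have h1 := (hg.dist_le_mul z z₀).trans
        (mul_le_mul_of_nonneg_left (hdist z z₀) L.coe_nonneg)
      rw [Real.dist_eq] at h1
      linarith [abs_sub_abs_le_abs_sub (g z) (g z₀)]
  have hknn := abs_expectedKnnError_sub_bayesError_le (transformedLaw P f) hk0 hk t (hγ n k) hdist
    (average_nnMeanDist_swap_le hd hk0 hk hB hA) hg hgm hK
  have hbayes := abs_bayesError_transformedLaw_sub_le P hf hgm hK
  have hcontr := integral_abs_labelProb_transformedLaw_sub_le P hf hgm hK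
  have hloss := integral_abs_labelProb_sub_le_sqrt_squaredLoss P hf hgm hK
  have hmul := mul_le_mul_of_nonneg_left hcontr (by positivity : 0 ≤ 2 * (γ + 1))
  have hmul' := mul_le_mul_of_nonneg_left hloss (by positivity : 0 ≤ 2 * γ + 4)
  have htri := abs_sub_le (expectedKnnError (transformedLaw P f) n k t)
    (bayesError (transformedLaw P f)) (bayesError P)
  refine le_rpow_quarter_of_le_sqrt (integral_nonneg fun x => sq_nonneg _) (by positivity)
    (by linarith) ?_ ?_
  · have h1 := expectedKnnError_mem_Icc (n := n) (transformedLaw P f) k t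
    have h2 := bayesError_mem_Icc P
    rw [abs_le]
    constructor <;> linarith [h1.1, h1.2, h2.1, h2.2]
  · linarith
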